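/- Let $a\in H^0(\mathbb P^2,\mathcal O(12))$ and $b\in H^0(\mathbb P^2,\mathcal O(18))$ be complex forms such that the Weierstrass threefold $$X=\{zy^2=x^3+a\,xz^2+b\,z^3\}\subset \mathbb P(\mathcal O(6)\oplus\mathcal O(9)\oplus\mathcal O)\to\mathbb P^2$$ is nonsingular (as it is for general $a,b$), and let $\pi:X\to\mathbb P^2$ be the projection. Let $\ell\in H_2(X,\mathbb Z)$ be the class of a line of $\mathbb P^2$ pushed through the zero section $[x:y:z]=[0:1:0]$, and let $f\in H_2(X,\mathbb Z)$ be the class of a fibre of $\pi$. For integers $n,i\ge 0$ let $W_{n,i}$ be the locus of those genus $0$ stable maps $u:C\to X$ without marked points, of class $u_*[C]=\ell+nf$, for which one component of $C$ is mapped by $u$ to a section of $\pi$ over a line of $\mathbb P^2$ with class $\ell+if$, and every other component is mapped into a fibre of $\pi$. Then: 1. For every $n\ge 0$, the loci $W_{n,1}$ and $W_{n,2}$ are empty. 2. More generally, if $L\subset\mathbb P^2$ is a line and $\sigma:L\to X$ is a section of $\pi$ over $L$ whose class is $\sigma_*[L]=\ell+if$ with $i\in\mathbb Z$, then $i=0$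 or $i\ge 3$. -/

import Mathlib

open MvPolynomial CategoryTheory LinearAlgebra.Projectivization

noncomputable section

namespace WeierstrassThreefold

/-! ### Projective spaces with the classical topology, singular homology -/

/-- The complex projective line (points over `ℂ`). -/
abbrev P1 : Type := ℙ ℂ (Fin 2 → ℂ)

/-- The complex projective plane (points over `ℂ`). -/
abbrev P2 : Type := ℙ ℂ (Fin 3 → ℂ)

/-- The classical topology of `ℙ¹`: the quotient topology from `ℂ² ∖ 0`. -/
instance : TopologicalSpace P1 :=
  TopologicalSpace.coinduced (Projectivization.mk' ℂ (V := Fin 2 → ℂ)) inferInstance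

/-- The second integral singular homology group of a topological space. -/
abbrev H2 (T : Type) [TopologicalSpace T] : Type :=
  (((AlgebraicTopology.singularHomologyFunctor (ModuleCat.{0} ℤ) 2).obj
    (ModuleCat.of ℤ ℤ)).obj (TopCat.of T) : ModuleCat.{0} ℤ)

/-- The pushforward `g_* : H₂(S; ℤ) → H₂(T; ℤ)` of a continuous map `g : S → T`. -/
def H2.push {S T : Type} [TopologicalSpace S] [TopologicalSpace T] (g : C(S, T)) :
    H2 S →ₗ[ℤ] H2 T :=
  (((AlgebraicTopology.singularHomologyFunctor (ModuleCat.{0} ℤ) 2).obj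
    (ModuleCat.of ℤ ℤ)).map (TopCat.ofHom g)).hom

/-! ### The Weierstrass threefold

`ℙ(𝒪(6) ⊕ 𝒪(9) ⊕ 𝒪)` over `ℙ²` is the quotient of the pairs `(s, w)` with
`s ∈ ℂ³ ∖ 0` and `w = (x, y, z) ∈ ℂ³ ∖ 0` by the action
`(c, m) • (s; x, y, z) = (c s; c⁶ m x, c⁹ m y, m z)` of `ℂˣ × ℂˣ`. -/

/-- The form `z y² - (x³ + a x z² + b z³)`, in the variables `s₀, s₁, s₂` (left summand) and
`x, y, z` (right summand). -/
def weierstrassForm (a b : MvPolynomial (Fin 3) ℂ) : MvPolynomial (Fin 3 ⊕ Fin 3) ℂ :=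
  X (Sum.inr 2) * X (Sum.inr 1) ^ 2 -
    (X (Sum.inr 0) ^ 3 + rename Sum.inl a * X (Sum.inr 0) * X (Sum.inr 2) ^ 2 +
      rename Sum.inl b * X (Sum.inr 2) ^ 3)

/-- Homogeneous coordinates of the points of the Weierstrass threefold. -/
abbrev Cone (a b : MvPolynomial (Fin 3) ℂ) : Type :=
  {v : (Fin 3 → ℂ) × (Fin 3 → ℂ) //
    v.1 ≠ 0 ∧ v.2 ≠ 0 ∧ eval (Sum.elim v.1 v.2) (weierstrassForm a b) = 0}

/-- Two tuples of homogeneous coordinates give the same point when they differ by the action of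
`ℂˣ × ℂˣ`. -/
instance coneSetoid (a b : MvPolynomial (Fin 3) ℂ) : Setoid (Cone a b) where
  r v v' := ∃ c m : ℂˣ, v'.1.1 = (fun j => (c : ℂ) * v.1.1 j) ∧
    v'.1.2 = ![(c : ℂ) ^ 6 * m * v.1.2 0, (c : ℂ) ^ 9 * m * v.1.2 1, m * v.1.2 2]
  iseqv := by
    refine ⟨fun v => ⟨1, 1, by simp, ?_⟩, ?_, ?_⟩
    · funext j; fin_cases j <;> simp
    · rintro v v' ⟨c, m, h1, h2⟩
      refine ⟨c⁻¹, m⁻¹, ?_, ?_⟩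
      · funext j; simp [h1]
      · have hc : (c : ℂ) ≠ 0 := c.ne_zero
        have hm : (m : ℂ) ≠ 0 := m.ne_zero
        funext j; fin_cases j <;> simp [h2] <;> field_simp
    · rintro v v' v'' ⟨c, m, h1, h2⟩ ⟨c', m', h1', h2'⟩
      refine ⟨c' * c, m' * m, ?_, ?_⟩
      · funext j; simp [h1, h1', mul_assoc]
      · funext j; fin_cases j <;> simp [h2, h2'] <;> ring

/-- The Weierstrass fibration `z y² = x³ + a x z² + b z³` in `ℙ(𝒪(6) ⊕ 𝒪(9) ⊕ 𝒪)`, as the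
topological space of its complex points. -/
abbrev Threefold (a b : MvPolynomial (Fin 3) ℂ) : Type := Quotient (coneSetoid a b)

/-- The threefold is nonsingular: at every point some partial derivative of its equation is
nonzero. -/
def IsNonsingular (a b : MvPolynomial (Fin 3) ℂ) : Prop :=
  ∀ v : Cone a b, ∃ j, eval (Sum.elim v.1.1 v.1.2) (pderiv j (weierstrassForm a b)) ≠ 0

/-- The fibration `π : X → ℙ²`. -/
def proj {a b : MvPolynomial (Fin 3) ℂ} : Threefold a b → P2 :=
  Quotient.lift (fun v => Projectivization.mk ℂ v.1.1 v.2.1) (by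
    rintro v v' ⟨c, m, h1, -⟩
    refine ((Projectivization.mk_eq_mk_iff ℂ _ _ _ _).2 ⟨c, ?_⟩).symm
    rw [h1]; rfl)

/-- The discriminant curve `4 a³ + 27 b² = 0` in `ℙ²`. -/
def discriminantCurve (a b : MvPolynomial (Fin 3) ℂ) : Set P2 :=
  {p | eval p.rep (4 * a ^ 3 + 27 * b ^ 2) = 0}

/-! ### Morphisms `ℙ¹ → X` -/

/-- `P` is a section of `𝒪(m)` on `ℙ¹`: a form of degree `m`, hence zero if `m < 0`. -/
def IsForm (m : ℤ) (P : MvPolynomial (Fin 2) ℂ) : Prop :=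
  P = 0 ∨ ∃ k : ℕ, (k : ℤ) = m ∧ P.IsHomogeneous k

/-- The map `u : ℙ¹ → X` is a morphism of algebraic varieties. A morphism to `ℙ²` is given by three
forms `F` of one degree `d` without common zeros; a lift of it to the projective bundle is a
sub-line-bundle `𝒪(-e) ⊂ 𝒪(6 d) ⊕ 𝒪(9 d) ⊕ 𝒪`, that is, forms `G 0, G 1, G 2` of degrees `6 d + e`,
`9 d + e`, `e` without common zeros. -/
def IsMorphism {a b : MvPolynomial (Fin 3) ℂ} (u : P1 → Threefold a b) : Prop :=
  ∃ (d : ℕ) (e : ℤ) (F G : Fin 3 → MvPolynomial (Fin 2) ℂ),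
    (∀ j, IsForm d (F j)) ∧ IsForm (6 * d + e) (G 0) ∧ IsForm (9 * d + e) (G 1) ∧
    IsForm e (G 2) ∧
    ∀ (t : Fin 2 → ℂ) (ht : t ≠ 0), ∃ v : Cone a b,
      v.1.1 = (fun j => eval t (F j)) ∧ v.1.2 = (fun j => eval t (G j)) ∧
      u (Projectivization.mk ℂ t ht) = ⟦v⟧

theorem IsMorphism.continuous {a b : MvPolynomial (Fin 3) ℂ} {u : P1 → Threefold a b}
    (hu : IsMorphism u) : Continuous u := by
  obtain ⟨d, e, F, G, -, -, -, -, h⟩ := hu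
  refine continuous_coinduced_dom.2 ?_
  choose v h1 h2 h3 using h
  have hv : Continuous fun t : {t : Fin 2 → ℂ // t ≠ 0} => v t.1 t.2 := by
    refine Continuous.subtype_mk (Continuous.prodMk ?_ ?_) _
    · simp only [h1]
      exact continuous_pi fun j => (MvPolynomial.continuous_eval (F j)).comp continuous_subtype_val
    · simp only [h2]
      exact continuous_pi fun j => (MvPolynomial.continuous_eval (G j)).comp continuous_subtype_val
  have : u ∘ Projectivization.mk' ℂ =
      fun t : {t : Fin 2 → ℂ // t ≠ 0} => (⟦v t.1 t.2⟧ : Threefold a b) := by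
    funext t; exact h3 t.1 t.2
  rw [this]
  exact continuous_quotient_mk'.comp hv

/-- Morphisms `ℙ¹ → X`. -/
abbrev Mor (a b : MvPolynomial (Fin 3) ℂ) : Type := {u : P1 → Threefold a b // IsMorphism u}

/-- The class `u_*[ℙ¹] ∈ H₂(X; ℤ)`, where `o = [ℙ¹]`. -/
def Mor.push {a b : MvPolynomial (Fin 3) ℂ} (u : Mor a b) (o : H2 P1) : H2 (Threefold a b) :=
  H2.push ⟨u.1, u.2.continuous⟩ o

/-- The point `[s; 0 : 1 : 0]` of the zero section, in homogeneous coordinates. -/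
def zeroSectionCone (a b : MvPolynomial (Fin 3) ℂ) (s : Fin 3 → ℂ) (hs : s ≠ 0) : Cone a b :=
  ⟨(s, ![0, 1, 0]), hs, fun h => by simpa using congrFun h 1, by simp [weierstrassForm]⟩

/-- The line `[t₀ : t₁] ↦ [t₀ : t₁ : 0]` of `ℙ²`, pushed through the zero section of `X → ℙ²`. -/
def zeroSectionLine (a b : MvPolynomial (Fin 3) ℂ) : Mor a b :=
  have hne : ∀ {t : Fin 2 → ℂ}, t ≠ 0 → (![t 0, t 1, 0] : Fin 3 → ℂ) ≠ 0 := fun {t} ht h => ht <| by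
    funext j
    fin_cases j
    · simpa using congrFun h 0
    · simpa using congrFun h 1
  ⟨fun p => Quotient.liftOn' p
      (fun t => (⟦zeroSectionCone a b ![t.1 0, t.1 1, 0] (hne t.2)⟧ : Threefold a b)) (by
        rintro t t' ⟨c, hc⟩
        have hc' : ∀ j, t.1 j = (c : ℂ) * t'.1 j := fun j => (congrFun hc j).symm
        refine Quotient.sound ⟨c⁻¹, c ^ 9, ?_, ?_⟩
        · funext j; fin_cases j <;> simp [zeroSectionCone, hc']
        · funext j; fin_cases j <;> simp [zeroSectionCone]),
    1, -9, ![X 0, X 1, 0], ![0, 1, 0],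
    fun j => by
      fin_cases j
      · exact Or.inr ⟨1, rfl, isHomogeneous_X _ _⟩
      · exact Or.inr ⟨1, rfl, isHomogeneous_X _ _⟩
      · exact Or.inl rfl,
    Or.inl rfl, Or.inr ⟨0, rfl, isHomogeneous_one _ _⟩, Or.inl rfl,
    fun t ht => ⟨zeroSectionCone a b ![t 0, t 1, 0] (hne ht), by
      funext j; fin_cases j <;> simp [zeroSectionCone], by
      funext j; fin_cases j <;> simp [zeroSectionCone], rfl⟩⟩

/-- `o` is a generator of `H₂(ℙ¹; ℤ) ≅ ℤ`. -/
def IsFundamentalClass (o : H2 P1) : Prop := ∀ c : H2 P1, ∃ k : ℤ, c = k • o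

/-- The class `ℓ` of a line in `ℙ²` pushed through the zero section. -/
def lineClass (a b : MvPolynomial (Fin 3) ℂ) (o : H2 P1) : H2 (Threefold a b) :=
  (zeroSectionLine a b).push o

/-- `f` is the class of a fibre of `π`. All fibres are homologous, and a fibre over a point of the
discriminant is an irreducible rational curve; its class is `φ_*[ℙ¹]` for its normalization `φ`,
i.e. for a morphism `φ` from `ℙ¹` onto the fibre that is injective away from finitely many
points. -/
def IsFiberClass {a b : MvPolynomial (Fin 3) ℂ} (o : H2 P1) (f : H2 (Threefold a b)) : Prop :=
  ∃ φ : Mor a b, ∃ p ∈ discriminantCurve a b, Set.range φ.1 = proj ⁻¹' {p} ∧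
    {q : P1 | ∃ q', q' ≠ q ∧ φ.1 q' = φ.1 q}.Finite ∧ f = φ.push o

/-! ### Stable maps of genus zero -/

/-- A stable map of genus `0` without marked points to `X`. A connected nodal curve `C` of arithmetic
genus `0` is a tree of copies of `ℙ¹`: the component `v` is glued to an adjacent component `w` at
its point `node v w`, and different nodes on one component are different points. A map `C → X` is a
family of morphisms which agree at the nodes. It has finitely many automorphisms iff every
contracted component carries at least three nodes. -/
structure StableMap (a b : MvPolynomial (Fin 3) ℂ) where
  /-- the number of components of `C` -/
  size : ℕ
  /-- the dual graph of `C` -/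
  graph : SimpleGraph (Fin size)
  isTree : graph.IsTree
  /-- the nodes of `C` -/
  node : Fin size → Fin size → P1
  node_injOn : ∀ v, Set.InjOn (node v) (graph.neighborSet v)
  /-- the restriction of the map to each component -/
  map : Fin size → Mor a b
  map_node : ∀ v w, graph.Adj v w → (map v).1 (node v w) = (map w).1 (node w v)
  stable : ∀ v, (∀ q q' : P1, (map v).1 q = (map v).1 q') → 3 ≤ (graph.neighborSet v).ncard

/-- The class `u_*[C] ∈ H₂(X; ℤ)` of a stable map, where `o = [ℙ¹]`. -/
def StableMap.push {a b : MvPolynomial (Fin 3) ℂ} (u : StableMap a b) (o : H2 P1) :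
    H2 (Threefold a b) :=
  ∑ v, (u.map v).push o

/-- `σ : ℙ¹ → X` is a section over a line: `π ∘ σ` maps `ℙ¹` bijectively (hence isomorphically) onto
a line `L` of `ℙ²`. -/
def IsSectionOverLine {a b : MvPolynomial (Fin 3) ℂ} (σ : Mor a b) : Prop :=
  Function.Injective (fun q => proj (σ.1 q)) ∧
    ∃ c : Fin 3 → ℂ, c ≠ 0 ∧
      Set.range (fun q => proj (σ.1 q)) = {p : P2 | ∑ j, c j * p.rep j = 0}

/-- `u : ℙ¹ → X` is vertical: its image lies in one fibre of `π`. -/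
def IsVertical {a b : MvPolynomial (Fin 3) ℂ} (u : Mor a b) : Prop :=
  ∀ q q' : P1, proj (u.1 q) = proj (u.1 q')

/-- `W_{n,i}`: the stable maps of class `ℓ + n f` that consist of a horizontal component, a section
over a line, of class `ℓ + i f`, and of vertical components (of total class `(n - i) f`, as the
other two classes force). -/
def W {a b : MvPolynomial (Fin 3) ℂ} (o : H2 P1) (f : H2 (Threefold a b)) (n i : ℕ) :
    Set (StableMap a b) :=
  {u | u.push o = lineClass a b o + n • f ∧
    ∃ v, IsSectionOverLine (u.map v) ∧ (u.map v).push o = lineClass a b o + i • f ∧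
      ∀ w, w ≠ v → IsVertical (u.map w)}

end WeierstrassThreefold

end

/-! A degree count. On $X$ take the line bundle $M=\mathcal O(1)\otimes\pi^*\mathcal O(9)$, which is
generated by the sections $y$, $xs_j^3$, $zs_j^9$. On a rational curve with homogeneous coordinates
of twists $d,e$ its degree is $9d+e$. This is $0$ on the line in the zero section. For a section
over a line there are two cases. If $z$ vanishes identically on it, then $y$ vanishes nowhere and
the degree is $0$. Otherwise $z$ is a nonzero form of degree $e\ge 0$ and $d\ge 1$, so the degree is
at least $9$ (`degree_section`). On a fibre, a plane cubic cut by the lines $y=cz$, the degree lies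
between $1$ and $3$ (`degree_fiber`). Hence $\ell+if$ has degree $i\deg f$, which is $0$ or at least
$9$, and so $i=0$ or $i\ge 3$. The emptiness of $W_{n,1}$ and $W_{n,2}$ follows by applying this to
the horizontal component.

The classes live in singular homology, so the degree must be a homomorphism on $H_2$. A line bundle
is presented as a continuous field of rank one projections. Its Chern class is a singular cocycle
that measures the winding of lifts of a triangle against chosen lifts of its edges. On an explicit
two-triangle cycle in $\mathbb P^1$ it takes the value $2\pi i(9d+e)$ (`chernHom_push`), and
`degree_eq_of_push_eq` turns relations in $H_2$ into relations of degrees. -/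

noncomputable section

/-! ### Singular chains and the pairing of cocycles with $H_2$ -/

section

open scoped Simplicial

/-- The inclusion of the `i`-th facet of the standard `n + 1`-simplex. -/
def simplexFace {n : ℕ} (i : Fin (n + 2)) :
    C(stdSimplex ℝ (Fin (n + 1)), stdSimplex ℝ (Fin (n + 2))) :=
  ⟨stdSimplex.map i.succAbove, stdSimplex.continuous_map _⟩

namespace WeierstrassThreefold

/-- The singular chain complex whose second homology is `H2`. -/
abbrev singularChains (T : Type) [TopologicalSpace T] : ChainComplex (ModuleCat.{0} ℤ) ℕ :=
  (TopCat.toSSet.obj (TopCat.of T)).chainComplex (ModuleCat.of ℤ ℤ)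

/-- The inclusion of the summand of a singular simplex. -/
def singularSimplex {T : Type} [TopologicalSpace T] {n : ℕ}
    (s : C(stdSimplex ℝ (Fin (n + 1)), T)) : ModuleCat.of ℤ ℤ ⟶ (singularChains T).X n :=
  SSet.ιChainComplex _ ((TopCat.toSSetObjEquiv (TopCat.of T) (.op ⦋n⦌)).symm s)

theorem singularSimplex_d {T : Type} [TopologicalSpace T] {n : ℕ}
    (s : C(stdSimplex ℝ (Fin (n + 2)), T)) :
    singularSimplex s ≫ (singularChains T).d (n + 1) n =
      ∑ i : Fin (n + 2), (-1) ^ (i : ℕ) • singularSimplex (s.comp (simplexFace i)) := by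
  rw [singularSimplex, SSet.ιChainComplex_d]
  rfl

theorem singularSimplex_map {S T : Type} [TopologicalSpace S] [TopologicalSpace T] {n : ℕ}
    (g : C(S, T)) (s : C(stdSimplex ℝ (Fin (n + 1)), S)) :
    singularSimplex s ≫ (SSet.chainComplexMap (TopCat.toSSet.map (TopCat.ofHom g)) _).f n =
      singularSimplex (g.comp s) := by
  rw [singularSimplex, SSet.ι_chainComplexMap_f]
  rfl

/-- The class of the cycle `s₁ - s₂`, for singular `2`-simplices with the same boundary. -/
def simplexPairClass {S : Type} [TopologicalSpace S] (s₁ s₂ : C(stdSimplex ℝ (Fin 3), S))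
    (h : ∀ i, s₁.comp (simplexFace i) = s₂.comp (simplexFace i)) : H2 S :=
  ((singularChains S).liftCycles (singularSimplex s₁ - singularSimplex s₂) 1 (by simp)
    (by simp [Preadditive.sub_comp, singularSimplex_d, h]) ≫
      (singularChains S).homologyπ 2).hom (1 : ℤ)

/-- A complex valued function on singular simplices, extended linearly to chains. -/
def cochainHom {T : Type} [TopologicalSpace T] {n : ℕ}
    (c : C(stdSimplex ℝ (Fin (n + 1)), T) → ℂ) : (singularChains T).X n ⟶ ModuleCat.of ℤ ℂ :=
  Limits.Sigma.desc fun s => ModuleCat.ofHom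
    (LinearMap.toSpanSingleton ℤ ℂ (c (TopCat.toSSetObjEquiv (TopCat.of T) (.op ⦋n⦌) s)))

theorem singularSimplex_cochainHom {T : Type} [TopologicalSpace T] {n : ℕ}
    (c : C(stdSimplex ℝ (Fin (n + 1)), T) → ℂ) (s : C(stdSimplex ℝ (Fin (n + 1)), T)) :
    singularSimplex s ≫ cochainHom c = ModuleCat.ofHom (LinearMap.toSpanSingleton ℤ ℂ (c s)) := by
  rw [singularSimplex, cochainHom, SSet.ιChainComplex]
  refine (Limits.Sigma.ι_desc _ _).trans ?_
  rw [Equiv.apply_symm_apply]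

theorem d_cochainHom {T : Type} [TopologicalSpace T] {n : ℕ}
    (c : C(stdSimplex ℝ (Fin (n + 1)), T) → ℂ)
    (hc : ∀ r : C(stdSimplex ℝ (Fin (n + 2)), T),
      ∑ j : Fin (n + 2), (-1) ^ (j : ℕ) * c (r.comp (simplexFace j)) = 0) :
    (singularChains T).d (n + 1) n ≫ cochainHom c = 0 := by
  refine SSet.chainComplex_hom_ext fun x => ?_
  obtain ⟨r, rfl⟩ := (TopCat.toSSetObjEquiv (TopCat.of T) (.op ⦋n + 1⦌)).symm.surjective x
  change singularSimplex r ≫ _ = singularSimplex r ≫ 0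
  rw [← Category.assoc, singularSimplex_d, Preadditive.sum_comp]
  ext
  simpa [singularSimplex_cochainHom] using hc r

/-- The homomorphism on `H₂` defined by a cocycle. -/
def cocycleHom {T : Type} [TopologicalSpace T] (c : C(stdSimplex ℝ (Fin 3), T) → ℂ)
    (hc : ∀ r : C(stdSimplex ℝ (Fin 4), T),
      ∑ j : Fin 4, (-1) ^ (j : ℕ) * c (r.comp (simplexFace j)) = 0) : H2 T →ₗ[ℤ] ℂ :=
  ((singularChains T).homologyι 2 ≫ (singularChains T).descOpcycles (cochainHom c) 3 (by simp)
    (d_cochainHom c hc)).hom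

/-- Naturality reduces the pairing to the level of chains, so cocycles can be evaluated without
computing any homology group. -/
theorem cocycleHom_push_simplexPairClass {S T : Type} [TopologicalSpace S] [TopologicalSpace T]
    (c : C(stdSimplex ℝ (Fin 3), T) → ℂ)
    (hc : ∀ r : C(stdSimplex ℝ (Fin 4), T),
      ∑ j : Fin 4, (-1) ^ (j : ℕ) * c (r.comp (simplexFace j)) = 0)
    (g : C(S, T)) (s₁ s₂ : C(stdSimplex ℝ (Fin 3), S))
    (h : ∀ i, s₁.comp (simplexFace i) = s₂.comp (simplexFace i)) :
    cocycleHom c hc (H2.push g (simplexPairClass s₁ s₂ h)) = c (g.comp s₁) - c (g.comp s₂) := by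
  have key : ((singularChains S).liftCycles (singularSimplex s₁ - singularSimplex s₂) 1 (by simp)
      (by simp [Preadditive.sub_comp, singularSimplex_d, h]) ≫ (singularChains S).homologyπ 2) ≫
      HomologicalComplex.homologyMap
        (SSet.chainComplexMap (TopCat.toSSet.map (TopCat.ofHom g)) _) 2 ≫
      (singularChains T).homologyι 2 ≫ (singularChains T).descOpcycles (cochainHom c) 3 (by simp)
        (d_cochainHom c hc) =
      ModuleCat.ofHom (LinearMap.toSpanSingleton ℤ ℂ (c (g.comp s₁) - c (g.comp s₂))) := by
    have e1 := singularSimplex_map g s₁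
    have e2 := singularSimplex_map g s₂
    have e3 := singularSimplex_cochainHom c (g.comp s₁)
    have e4 := singularSimplex_cochainHom c (g.comp s₂)
    rw [Category.assoc, HomologicalComplex.homologyπ_naturality_assoc,
      HomologicalComplex.homology_π_ι_assoc, HomologicalComplex.p_descOpcycles,
      HomologicalComplex.cyclesMap_i_assoc, HomologicalComplex.liftCycles_i_assoc,
      Preadditive.sub_comp, ← Category.assoc, ← Category.assoc, e1, e2, e3, e4]
    ext
    simp
  exact (congrArg (fun f => f.hom (1 : ℤ)) key).trans (one_smul ℤ _)

end WeierstrassThreefold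

end

/-! ### Logarithms and lifts over contractible spaces -/

section

open scoped unitInterval Topology

/-- A nowhere zero function on a compact contractible space has a logarithm. -/
theorem ContinuousMap.exists_eq_exp {K : Type*} [TopologicalSpace K] [CompactSpace K]
    [ContractibleSpace K] (g : C(K, ℂ)) (hg : ∀ k, g k ≠ 0) :
    ∃ l : C(K, ℂ), ∀ k, g k = Complex.exp (l k) := by
  obtain ⟨k₀, ⟨F⟩⟩ := id_nullhomotopic K
  let G (t : I) : C(K, ℂ) := ⟨fun k => g (F (t, k)), by fun_prop⟩
  have hlog : ∀ t s : I, (∃ l : C(K, ℂ), ∀ k, G t k = Complex.exp (l k)) ↔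
      ∃ l : C(K, ℂ), ∀ k, G s k = Complex.exp (l k) := by
    intro t s
    -- At nearby times the ratio is uniformly close to $1$, where the principal logarithm is
    -- continuous. Having a logarithm is thus locally constant along the contraction, and it holds
    -- at time $1$, where the function is constant.
    have hstep : ∀ t, ∀ᶠ s in 𝓝 t, ∃ m : C(K, ℂ), ∀ k, G s k = G t k * Complex.exp (m k) := by
      intro t
      let R : C(I, C(K, ℂ)) := ContinuousMap.curry
        ⟨fun p => g (F p) / g (F (t, p.2)), by
          refine Continuous.div (by fun_prop) (by fun_prop) fun p => hg _⟩
      have hR : ∀ᶠ s in 𝓝 t, dist (R s) (R t) < 1 :=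
        R.continuous.tendsto t (Metric.ball_mem_nhds (R t) one_pos)
      filter_upwards [hR] with s hs
      have hslit : ∀ k, R s k ∈ Complex.slitPlane := by
        intro k
        have h1 := (ContinuousMap.dist_apply_le_dist (f := R s) (g := R t) k).trans_lt hs
        have h2 : R t k = 1 := div_self (hg _)
        rw [h2] at h1
        exact Complex.ball_one_subset_slitPlane h1
      refine ⟨⟨fun k => Complex.log (R s k), ?_⟩, fun k => ?_⟩
      · exact (R s).continuous.clog hslit
      · change _ = _ * Complex.exp (Complex.log (R s k))
        rw [Complex.exp_log (Complex.slitPlane_ne_zero (hslit k))]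
        exact (mul_div_cancel₀ _ (hg _)).symm
    refine PreconnectedSpace.induction₂'
      (fun t s => (∃ l : C(K, ℂ), ∀ k, G t k = Complex.exp (l k)) ↔
        ∃ l : C(K, ℂ), ∀ k, G s k = Complex.exp (l k)) (fun t => ?_) ⟨fun _ _ _ => Iff.trans⟩ t s
    filter_upwards [hstep t] with s ⟨m, hm⟩
    have : (∃ l : C(K, ℂ), ∀ k, G t k = Complex.exp (l k)) ↔
        ∃ l : C(K, ℂ), ∀ k, G s k = Complex.exp (l k) := by
      constructor
      · rintro ⟨l, hl⟩
        exact ⟨l + m, fun k => by simp [hm, hl, Complex.exp_add]⟩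
      · rintro ⟨l, hl⟩
        refine ⟨l - m, fun k => ?_⟩
        rw [ContinuousMap.sub_apply, Complex.exp_sub, ← hl, hm,
          mul_div_cancel_right₀ _ (Complex.exp_ne_zero _)]
    exact ⟨this, this.symm⟩
  have h0 := (hlog 1 0).1 ⟨.const K (Complex.log (g k₀)), fun k => by
    simp [G, Complex.exp_log (hg _)]⟩
  simpa [G] using h0

/-- Two logarithms of one function differ by a constant, by uniqueness of lifts along the covering
`Complex.exp`. -/
theorem Complex.sub_eq_sub_of_exp_eq_exp {K : Type*} [TopologicalSpace K] [PreconnectedSpace K]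
    (l m : C(K, ℂ)) (h : ∀ k, Complex.exp (l k) = Complex.exp (m k)) (a b : K) :
    l b - l a = m b - m a := by
  have hc : Complex.exp (l a - m a) = 1 := by
    rw [Complex.exp_sub, h, div_self (Complex.exp_ne_zero _)]
  have := Complex.isCoveringMap_exp.eq_of_comp_eq l.continuous
    (g₂ := fun k => m k + (l a - m a)) (by fun_prop)
    (by funext k; simp [Complex.exp_add, hc, h]) a (by simp)
  rw [congrFun this b]
  ring

/-- A line subbundle of a trivial bundle, given by projections onto the lines. -/
structure LineField (T E : Type*) [TopologicalSpace T] [NormedAddCommGroup E]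
    [InnerProductSpace ℂ E] where
  /-- the projection onto the line over a point -/
  P : C(T, E →L[ℂ] E)
  idem : ∀ x v, P x (P x v) = P x v
  rank_one : ∀ x v v', v ≠ 0 → P x v = v → P x v' = v' → ∃ c : ℂ, v' = c • v

namespace LineField

variable {T E : Type*} [TopologicalSpace T] [NormedAddCommGroup E] [InnerProductSpace ℂ E]
  (L : LineField T E)

/-- `v` is a nowhere zero section of the pullback of the line bundle along `f`. -/
def IsLift {K : Type*} [TopologicalSpace K] (f : C(K, T)) (v : C(K, E)) : Prop :=
  ∀ k, v k ≠ 0 ∧ L.P (f k) (v k) = v k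

variable {L} in
theorem IsLift.comp {K K' : Type*} [TopologicalSpace K] [TopologicalSpace K'] {f : C(K, T)}
    {v : C(K, E)} (h : L.IsLift f v) (g : C(K', K)) : L.IsLift (f.comp g) (v.comp g) :=
  fun k => h (g k)

variable {L} in
-- Project $v$ onto the new lines. If the projection vanished at a point, the difference of the
-- projections would map $v$ to $-v$ there and have norm at least $1$.
theorem IsLift.exists_of_dist_lt {K : Type*} [TopologicalSpace K] {f f' : C(K, T)}
    {v : C(K, E)} (h : L.IsLift f v) (hf : ∀ k, dist (L.P (f' k)) (L.P (f k)) < 1) :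
    ∃ v', L.IsLift f' v' := by
  refine ⟨⟨fun k => L.P (f' k) (v k), by fun_prop⟩, fun k => ⟨fun h0 => ?_, L.idem _ _⟩⟩
  have h1 : (L.P (f' k) - L.P (f k)) (v k) = - v k := by
    change L.P (f' k) (v k) = 0 at h0
    simp [h0, (h k).2]
  have h2 := (L.P (f' k) - L.P (f k)).le_opNorm (v k)
  rw [h1, norm_neg, ← dist_eq_norm] at h2
  have h3 := norm_pos_iff.2 (h k).1
  nlinarith [hf k]

/-- Liftability is locally constant along a contraction, by the previous lemma, and a constant map
lifts. -/
theorem exists_isLift {K : Type*} [TopologicalSpace K] [CompactSpace K] [ContractibleSpace K]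
    (hL : ∀ x, ∃ v, v ≠ 0 ∧ L.P x v = v) (f : C(K, T)) : ∃ v, L.IsLift f v := by
  obtain ⟨k₀, ⟨F⟩⟩ := id_nullhomotopic K
  let G (t : I) : C(K, T) := ⟨fun k => f (F (t, k)), by fun_prop⟩
  let R : C(I, C(K, E →L[ℂ] E)) := ContinuousMap.curry ⟨fun p => L.P (f (F p)), by fun_prop⟩
  have hlift : ∀ t s : I, (∃ v, L.IsLift (G t) v) ↔ ∃ v, L.IsLift (G s) v := by
    intro t s
    refine PreconnectedSpace.induction₂'
      (fun t s => (∃ v, L.IsLift (G t) v) ↔ ∃ v, L.IsLift (G s) v) (fun t => ?_)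
      ⟨fun _ _ _ => Iff.trans⟩ t s
    have hR : ∀ᶠ s in 𝓝 t, dist (R s) (R t) < 1 :=
      R.continuous.tendsto t (Metric.ball_mem_nhds (R t) one_pos)
    filter_upwards [hR] with s hs
    have h1 : ∀ k, dist (L.P (G s k)) (L.P (G t k)) < 1 := fun k =>
      (ContinuousMap.dist_apply_le_dist (f := R s) (g := R t) k).trans_lt hs
    have : (∃ v, L.IsLift (G t) v) ↔ ∃ v, L.IsLift (G s) v :=
      ⟨fun ⟨v, hv⟩ => hv.exists_of_dist_lt h1,
        fun ⟨v, hv⟩ => hv.exists_of_dist_lt fun k => dist_comm (L.P (G s k)) _ ▸ h1 k⟩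
    exact ⟨this, this.symm⟩
  obtain ⟨v₀, hv₀⟩ := hL (f k₀)
  obtain ⟨v, hv⟩ := (hlift 1 0).1 ⟨.const K v₀, fun k => by simpa [G] using hv₀⟩
  exact ⟨v, fun k => by simpa [G] using hv k⟩

variable {L} in
theorem IsLift.exists_exp_smul {K : Type*} [TopologicalSpace K] [CompactSpace K]
    [ContractibleSpace K] {f : C(K, T)} {v v' : C(K, E)} (h : L.IsLift f v)
    (h' : L.IsLift f v') : ∃ l : C(K, ℂ), ∀ k, v' k = Complex.exp (l k) • v k := by
  have hne : ∀ k, inner ℂ (v k) (v k) ≠ 0 := fun k => inner_self_ne_zero.2 (h k).1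
  have hr : ∀ k, v' k = (inner ℂ (v k) (v' k) / inner ℂ (v k) (v k)) • v k := by
    intro k
    obtain ⟨c, hc⟩ := L.rank_one _ _ _ (h k).1 (h k).2 (h' k).2
    rw [hc, inner_smul_right, mul_div_cancel_right₀ _ (hne k)]
  let g : C(K, ℂ) := ⟨fun k => inner ℂ (v k) (v' k) / inner ℂ (v k) (v k),
    Continuous.div (by fun_prop) (by fun_prop) hne⟩
  obtain ⟨l, hl⟩ := g.exists_eq_exp fun k h0 => (h' k).1 (by
    rw [hr k]; change g k • _ = _; rw [h0, zero_smul])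
  exact ⟨l, fun k => by rw [← hl k]; exact hr k⟩

end LineField

end

/-! ### The first Chern class as a singular cocycle -/

instance stdSimplex.contractibleSpace {ι : Type*} [Fintype ι] [Nonempty ι] :
    ContractibleSpace (stdSimplex ℝ ι) :=
  (convex_stdSimplex ℝ ι).contractibleSpace (Set.nonempty_coe_sort.1 inferInstance)

theorem simplexFace_vertex {n : ℕ} (i : Fin (n + 2)) (j : Fin (n + 1)) :
    simplexFace i (stdSimplex.vertex j) = stdSimplex.vertex (i.succAbove j) :=
  stdSimplex.map_vertex _ _

theorem simplexFace_comp_simplexFace {n : ℕ} (j : Fin (n + 3)) (i : Fin (n + 2)) (j' : Fin (n + 3))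
    (i' : Fin (n + 2)) (h : ∀ k, j.succAbove (i.succAbove k) = j'.succAbove (i'.succAbove k)) :
    (simplexFace j).comp (simplexFace i) = (simplexFace j').comp (simplexFace i') := by
  ext1 x
  have : j.succAbove ∘ i.succAbove = j'.succAbove ∘ i'.succAbove := funext h
  change stdSimplex.map _ (stdSimplex.map _ x) = stdSimplex.map _ (stdSimplex.map _ x)
  rw [stdSimplex.map_comp_apply, stdSimplex.map_comp_apply]
  exact congrArg (fun f => stdSimplex.map f x) this

section Turn

variable {E : Type*} [NormedAddCommGroup E] [NormedSpace ℂ E]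

open Classical in
/-- The variation of the logarithm of the ratio of two proportional paths of vectors. -/
def turn (v v' : C(stdSimplex ℝ (Fin 2), E)) : ℂ :=
  if h : ∃ l : C(stdSimplex ℝ (Fin 2), ℂ), ∀ k, v' k = Complex.exp (l k) • v k then
    h.choose (stdSimplex.vertex 1) - h.choose (stdSimplex.vertex 0)
  else 0

theorem turn_eq {v v' : C(stdSimplex ℝ (Fin 2), E)} (hv : ∀ k, v k ≠ 0)
    (l : C(stdSimplex ℝ (Fin 2), ℂ)) (hl : ∀ k, v' k = Complex.exp (l k) • v k) :
    turn v v' = l (stdSimplex.vertex 1) - l (stdSimplex.vertex 0) := by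
  have h : ∃ l : C(stdSimplex ℝ (Fin 2), ℂ), ∀ k, v' k = Complex.exp (l k) • v k := ⟨l, hl⟩
  rw [turn, dif_pos h]
  refine Complex.sub_eq_sub_of_exp_eq_exp _ _ (fun k => ?_) _ _
  exact smul_left_injective ℂ (hv k) ((h.choose_spec k).symm.trans (hl k))

end Turn

namespace LineField

variable {T E : Type*} [TopologicalSpace T] [NormedAddCommGroup E] [InnerProductSpace ℂ E]
  (L : LineField T E) (hL : ∀ x, ∃ v, v ≠ 0 ∧ L.P x v = v)

theorem IsLift.turn_eq_add {L : LineField T E} {f : C(stdSimplex ℝ (Fin 2), T)}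
    {v v' v'' : C(stdSimplex ℝ (Fin 2), E)} (hv : L.IsLift f v) (hv' : L.IsLift f v')
    (l : C(stdSimplex ℝ (Fin 2), ℂ)) (hl : ∀ k, v'' k = Complex.exp (l k) • v' k) :
    turn v v'' = turn v v' + (l (stdSimplex.vertex 1) - l (stdSimplex.vertex 0)) := by
  obtain ⟨m, hm⟩ := hv.exists_exp_smul hv'
  rw [turn_eq (fun k => (hv k).1) m hm, turn_eq (fun k => (hv k).1) (l + m) fun k => by
    rw [hl, hm, smul_smul, ContinuousMap.add_apply, Complex.exp_add]]
  simp only [ContinuousMap.add_apply]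
  ring

/-- A chosen lift of a singular simplex. -/
def lift {n : ℕ} (f : C(stdSimplex ℝ (Fin (n + 1)), T)) : C(stdSimplex ℝ (Fin (n + 1)), E) :=
  (L.exists_isLift hL f).choose

theorem isLift_lift {n : ℕ} (f : C(stdSimplex ℝ (Fin (n + 1)), T)) : L.IsLift f (L.lift hL f) :=
  (L.exists_isLift hL f).choose_spec

/-- The first Chern class, as a singular cocycle: the variation along the boundary of a
`2`-simplex of the ratio between a lift of the simplex and the chosen lifts of the edges. -/
def chernCocycle (f : C(stdSimplex ℝ (Fin 3), T)) : ℂ :=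
  ∑ i : Fin 3, (-1) ^ (i : ℕ) *
    turn (L.lift hL (f.comp (simplexFace i))) ((L.lift hL f).comp (simplexFace i))

theorem sum_sub_vertex_eq_zero (l : C(stdSimplex ℝ (Fin 3), ℂ)) :
    ∑ i : Fin 3, (-1) ^ (i : ℕ) * (l (simplexFace i (stdSimplex.vertex 1)) -
      l (simplexFace i (stdSimplex.vertex 0))) = 0 := by
  simp only [simplexFace_vertex, Fin.sum_univ_three]
  have h1 : (0 : Fin 3).succAbove (1 : Fin 2) = 2 := rfl
  have h2 : (0 : Fin 3).succAbove (0 : Fin 2) = 1 := rfl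
  have h3 : (1 : Fin 3).succAbove (1 : Fin 2) = 2 := rfl
  have h4 : (1 : Fin 3).succAbove (0 : Fin 2) = 0 := rfl
  have h5 : (2 : Fin 3).succAbove (1 : Fin 2) = 1 := rfl
  have h6 : (2 : Fin 3).succAbove (0 : Fin 2) = 0 := rfl
  rw [h1, h2, h3, h4, h5, h6]
  simp

/-- Another lift of the triangle differs by the exponential of a function on the whole triangle,
whose variations around the boundary cancel. -/
theorem IsLift.chernCocycle_eq {L : LineField T E} (hL : ∀ x, ∃ v, v ≠ 0 ∧ L.P x v = v)
    {f : C(stdSimplex ℝ (Fin 3), T)} {v : C(stdSimplex ℝ (Fin 3), E)} (hv : L.IsLift f v) :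
    L.chernCocycle hL f = ∑ i : Fin 3, (-1) ^ (i : ℕ) *
      turn (L.lift hL (f.comp (simplexFace i))) (v.comp (simplexFace i)) := by
  obtain ⟨l, hl⟩ := (L.isLift_lift hL f).exists_exp_smul hv
  have h : ∀ i : Fin 3, turn (L.lift hL (f.comp (simplexFace i))) (v.comp (simplexFace i)) =
      turn (L.lift hL (f.comp (simplexFace i))) ((L.lift hL f).comp (simplexFace i)) +
        (l (simplexFace i (stdSimplex.vertex 1)) - l (simplexFace i (stdSimplex.vertex 0))) :=
    fun i => (L.isLift_lift hL _).turn_eq_add ((L.isLift_lift hL f).comp _)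
      (l.comp (simplexFace i)) fun k => hl _
  simp only [h, mul_add, Finset.sum_add_distrib, sum_sub_vertex_eq_zero, add_zero]
  rfl

/-- One lift of the tetrahedron restricts to lifts of all four faces. Each edge then contributes the
same `turn` twice, with opposite signs. -/
theorem chernCocycle_cocycle (r : C(stdSimplex ℝ (Fin 4), T)) :
    ∑ j : Fin 4, (-1) ^ (j : ℕ) * L.chernCocycle hL (r.comp (simplexFace j)) = 0 := by
  let t (e : C(stdSimplex ℝ (Fin 2), stdSimplex ℝ (Fin 4))) : ℂ :=
    turn (L.lift hL (r.comp e)) ((L.lift hL r).comp e)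
  have h : ∀ j : Fin 4, L.chernCocycle hL (r.comp (simplexFace j)) =
      ∑ i : Fin 3, (-1) ^ (i : ℕ) * t ((simplexFace j).comp (simplexFace i)) := fun j =>
    ((L.isLift_lift hL r).comp (simplexFace j)).chernCocycle_eq hL
  have e1 := simplexFace_comp_simplexFace (n := 1) 1 0 0 0 (by decide)
  have e2 := simplexFace_comp_simplexFace (n := 1) 2 0 0 1 (by decide)
  have e3 := simplexFace_comp_simplexFace (n := 1) 3 0 0 2 (by decide)
  have e4 := simplexFace_comp_simplexFace (n := 1) 2 1 1 1 (by decide)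
  have e5 := simplexFace_comp_simplexFace (n := 1) 3 1 1 2 (by decide)
  have e6 := simplexFace_comp_simplexFace (n := 1) 3 2 2 2 (by decide)
  simp only [h, Fin.sum_univ_four, Fin.sum_univ_three]
  rw [e1, e2, e3, e4, e5, e6]
  norm_num
  ring

/-- The chosen edge lifts cancel in the difference; what remains is the winding of the clutching
function between the two lifts. -/
theorem chernCocycle_sub_eq {f₁ f₂ : C(stdSimplex ℝ (Fin 3), T)}
    (hf : ∀ i, f₁.comp (simplexFace i) = f₂.comp (simplexFace i))
    {v₁ v₂ : C(stdSimplex ℝ (Fin 3), E)} (hv₁ : L.IsLift f₁ v₁) (hv₂ : L.IsLift f₂ v₂)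
    (l : Fin 3 → C(stdSimplex ℝ (Fin 2), ℂ))
    (hl : ∀ i k, v₁ (simplexFace i k) = Complex.exp (l i k) • v₂ (simplexFace i k)) :
    L.chernCocycle hL f₁ - L.chernCocycle hL f₂ = ∑ i : Fin 3, (-1) ^ (i : ℕ) *
      (l i (stdSimplex.vertex 1) - l i (stdSimplex.vertex 0)) := by
  rw [hv₁.chernCocycle_eq hL, hv₂.chernCocycle_eq hL, ← Finset.sum_sub_distrib]
  refine Finset.sum_congr rfl fun i _ => ?_
  rw [hf i, (L.isLift_lift hL _).turn_eq_add (hv₂.comp (simplexFace i)) (l i) (hl i)]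
  ring

end LineField

/-! ### The projective line glued from two triangles -/

theorem simplexFace_apply_succAbove {n : ℕ} (i : Fin (n + 2)) (x : stdSimplex ℝ (Fin (n + 1)))
    (k : Fin (n + 1)) : simplexFace i x (i.succAbove k) = x k := by
  change FunOnFinite.linearMap ℝ ℝ i.succAbove x (i.succAbove k) = x k
  rw [FunOnFinite.linearMap_apply_apply, Finset.sum_eq_single k]
  · simp +contextual [Fin.succAbove_right_injective.eq_iff]
  · simp

theorem simplexFace_apply_self {n : ℕ} (i : Fin (n + 2)) (x : stdSimplex ℝ (Fin (n + 1))) :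
    simplexFace i x i = 0 := by
  change FunOnFinite.linearMap ℝ ℝ i.succAbove x i = 0
  rw [FunOnFinite.linearMap_apply_apply]
  refine Finset.sum_eq_zero fun k hk => absurd (Finset.mem_filter.1 hk).2 (Fin.succAbove_ne i k)

theorem exists_simplexFace_eq {n : ℕ} (i : Fin (n + 2)) (x : stdSimplex ℝ (Fin (n + 2)))
    (hx : x i = 0) : ∃ y, simplexFace i y = x := by
  refine ⟨⟨fun k => x (i.succAbove k), fun k => x.2.1 _, ?_⟩, ?_⟩
  · have := x.2.2
    rw [Fin.sum_univ_succAbove _ i] at this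
    change x i + _ = 1 at this
    rw [hx, zero_add] at this
    exact this
  · ext j
    rcases Fin.eq_self_or_eq_succAbove i j with rfl | ⟨k, rfl⟩
    · rw [simplexFace_apply_self, hx]
    · rw [simplexFace_apply_succAbove]; rfl

/-- The logarithm along the segment from `1` to `exp (i θ)`. -/
def segmentLog (θ : ℝ) (hθ : Real.sin θ ≠ 0) : C(stdSimplex ℝ (Fin 2), ℂ) where
  toFun x := Complex.log (x 0 + x 1 * Complex.exp (θ * Complex.I))
  continuous_toFun := by
    have hc : ∀ i, Continuous fun x : stdSimplex ℝ (Fin 2) => x i := fun i =>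
      (continuous_apply i).comp continuous_subtype_val
    refine Continuous.clog ?_ fun x => ?_
    · exact (Complex.continuous_ofReal.comp (hc 0)).add
        ((Complex.continuous_ofReal.comp (hc 1)).mul continuous_const)
    · rw [Complex.mem_slitPlane_iff]
      by_cases h : x 1 = 0
      · have := stdSimplex.add_eq_one x
        rw [h, add_zero] at this
        simp [h, this]
      · right
        simp [Complex.exp_ofReal_mul_I_im, h, hθ]

theorem exp_segmentLog (θ : ℝ) (hθ : Real.sin θ ≠ 0) (x : stdSimplex ℝ (Fin 2)) :
    Complex.exp (segmentLog θ hθ x) = x 0 + x 1 * Complex.exp (θ * Complex.I) := by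
  refine Complex.exp_log fun h => ?_
  have h1 := congrArg Complex.im h
  have h2 := congrArg Complex.re h
  have h3 := stdSimplex.add_eq_one x
  simp [Complex.exp_ofReal_mul_I_im, hθ] at h1
  simp [h1] at h2 h3
  simp [h2] at h3

theorem segmentLog_vertex_zero (θ : ℝ) (hθ : Real.sin θ ≠ 0) :
    segmentLog θ hθ (stdSimplex.vertex 0) = 0 := by
  simp [segmentLog]

theorem segmentLog_vertex_one (θ : ℝ) (hθ : Real.sin θ ≠ 0) (h1 : -Real.pi < θ)
    (h2 : θ ≤ Real.pi) : segmentLog θ hθ (stdSimplex.vertex 1) = θ * Complex.I := by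
  change Complex.log _ = _
  simp only [stdSimplex.vertex_coe]
  simp only [Pi.single_apply]
  norm_num
  rw [Complex.log_exp (by simpa using h1) (by simpa using h2)]

theorem sin_two_pi_div_three_ne_zero : Real.sin (2 * Real.pi / 3) ≠ 0 :=
  (Real.sin_pos_of_pos_of_lt_pi (by positivity) (by linarith [Real.pi_pos])).ne'

/-- The affine map of the triangle to `ℂ` with the cube roots of unity as vertices. -/
def triangle : C(stdSimplex ℝ (Fin 3), ℂ) where
  toFun x := x 0 + x 1 * Complex.exp (2 * Real.pi / 3 * Complex.I) +
    x 2 * Complex.exp (-(2 * Real.pi / 3) * Complex.I)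
  continuous_toFun := by
    have hc : ∀ i, Continuous fun x : stdSimplex ℝ (Fin 3) => x i := fun i =>
      (continuous_apply i).comp continuous_subtype_val
    have := fun i => Complex.continuous_ofReal.comp (hc i)
    exact ((this 0).add ((this 1).mul continuous_const)).add ((this 2).mul continuous_const)

/-- The logarithms of `triangle` along the edges. -/
def triangleLog : Fin 3 → C(stdSimplex ℝ (Fin 2), ℂ) :=
  -- With $\omega=e^{2\pi i/3}$, the edge opposite vertex $0$ runs from $\omega$ to $\omega^2$: it
  -- is $\omega$ times the segment from $1$ to $\omega$.
  ![.const _ (2 * Real.pi / 3 * Complex.I) + segmentLog _ sin_two_pi_div_three_ne_zero,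
    segmentLog (-(2 * Real.pi / 3)) (by simpa using sin_two_pi_div_three_ne_zero),
    segmentLog _ sin_two_pi_div_three_ne_zero]

theorem exp_triangleLog (i : Fin 3) (x : stdSimplex ℝ (Fin 2)) :
    Complex.exp (triangleLog i x) = triangle (simplexFace i x) := by
  have h0 : ∀ k, simplexFace i x (i.succAbove k) = x k := simplexFace_apply_succAbove i x
  have h1 := simplexFace_apply_self i x
  have hω : Complex.exp (-(2 * Real.pi / 3 * Complex.I)) =
      Complex.exp (2 * Real.pi / 3 * Complex.I) * Complex.exp (2 * Real.pi / 3 * Complex.I) := by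
    rw [← Complex.exp_add, Complex.exp_eq_exp_iff_exists_int]
    exact ⟨-1, by push_cast; ring⟩
  change _ = ((simplexFace i x 0 : ℝ) : ℂ) + (simplexFace i x 1 : ℝ) * _ +
    (simplexFace i x 2 : ℝ) * _
  fin_cases i
  · have ha : simplexFace 0 x 1 = x 0 := h0 0
    have hb : simplexFace 0 x 2 = x 1 := h0 1
    have hc : simplexFace 0 x 0 = 0 := h1
    simp [triangleLog, Complex.exp_add, exp_segmentLog, ha, hb, hc, hω]
    ring
  · have ha : simplexFace 1 x 0 = x 0 := h0 0
    have hb : simplexFace 1 x 2 = x 1 := h0 1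
    have hc : simplexFace 1 x 1 = 0 := h1
    simp [triangleLog, exp_segmentLog, ha, hb, hc]
  · have ha : simplexFace 2 x 0 = x 0 := h0 0
    have hb : simplexFace 2 x 1 = x 1 := h0 1
    have hc : simplexFace 2 x 2 = 0 := h1
    simp [triangleLog, exp_segmentLog, ha, hb, hc]

/-- Each edge contributes $2\pi i/3$. The middle edge runs from $1$ to $\omega^{-1}$, and its
negative variation meets the sign $-1$. -/
theorem sum_triangleLog : ∑ i : Fin 3, (-1) ^ (i : ℕ) *
    (triangleLog i (stdSimplex.vertex 1) - triangleLog i (stdSimplex.vertex 0)) =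
      2 * Real.pi * Complex.I := by
  have hpi := Real.pi_pos
  have h1 := segmentLog_vertex_one (2 * Real.pi / 3) sin_two_pi_div_three_ne_zero
    (by linarith) (by linarith)
  have h2 := segmentLog_vertex_one (-(2 * Real.pi / 3))
    (by simpa using sin_two_pi_div_three_ne_zero) (by linarith) (by linarith)
  simp only [Fin.sum_univ_three, triangleLog, Matrix.cons_val, ContinuousMap.add_apply,
    ContinuousMap.const_apply, h1, h2, segmentLog_vertex_zero]
  push_cast
  norm_num
  ring

/-- On the boundary `triangle` is an exponential, so its zeros are interior. -/
theorem triangle_ne_zero (x : stdSimplex ℝ (Fin 3)) (hx : triangle x = 0) (i : Fin 3) :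
    0 < x i := by
  refine (stdSimplex.zero_le x i).lt_of_ne fun h => ?_
  obtain ⟨y, rfl⟩ := exists_simplexFace_eq i x h.symm
  exact Complex.exp_ne_zero _ ((exp_triangleLog i y).trans hx)

/-- A lift to `ℂ²` of a singular simplex covering one half of the projective line. -/
def hemisphere₁ : C(stdSimplex ℝ (Fin 3), Fin 2 → ℂ) where
  -- The term $x_0x_1x_2$ is positive at any zero of `triangle`, which keeps the vector nonzero. It
  -- vanishes on the boundary, where the vector becomes `triangle x` times `hemisphere₂ x`.
  toFun x := ![triangle x, triangle x * star (triangle x) + ((x 0 * x 1 * x 2 : ℝ) : ℂ)]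
  continuous_toFun := by
    have hc : ∀ i, Continuous fun x : stdSimplex ℝ (Fin 3) => x i := fun i =>
      (continuous_apply i).comp continuous_subtype_val
    have := Complex.continuous_ofReal.comp (((hc 0).mul (hc 1)).mul (hc 2))
    refine continuous_pi fun j => ?_
    fin_cases j
    · exact triangle.continuous
    · exact (triangle.continuous.mul triangle.continuous.star).add this

/-- The lift to `ℂ²` of the other half of the projective line. -/
def hemisphere₂ : C(stdSimplex ℝ (Fin 3), Fin 2 → ℂ) where
  toFun x := ![1, star (triangle x)]
  continuous_toFun := by
    refine continuous_pi fun j => ?_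
    fin_cases j
    · exact continuous_const
    · exact triangle.continuous.star

theorem hemisphere₁_ne_zero (x : stdSimplex ℝ (Fin 3)) : hemisphere₁ x ≠ 0 := by
  intro h
  have h0 : triangle x = 0 := congrFun h 0
  have h1 : triangle x * star (triangle x) + ((x 0 * x 1 * x 2 : ℝ) : ℂ) = 0 := congrFun h 1
  have := triangle_ne_zero x h0
  rw [h0, zero_mul, zero_add, Complex.ofReal_eq_zero] at h1
  exact (mul_pos (mul_pos (this 0) (this 1)) (this 2)).ne' h1

theorem hemisphere₂_ne_zero (x : stdSimplex ℝ (Fin 3)) : hemisphere₂ x ≠ 0 := fun h =>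
  one_ne_zero (α := ℂ) (congrFun h 0)

theorem hemisphere_face (i : Fin 3) (x : stdSimplex ℝ (Fin 2)) :
    hemisphere₁ (simplexFace i x) =
      Complex.exp (triangleLog i x) • hemisphere₂ (simplexFace i x) := by
  have h : simplexFace i x 0 * simplexFace i x 1 * simplexFace i x 2 = 0 := by
    have := simplexFace_apply_self i x
    fin_cases i <;> simp_all
  rw [exp_triangleLog]
  funext j
  fin_cases j
  · simp [hemisphere₁, hemisphere₂]
  · simp only [hemisphere₁, hemisphere₂, ContinuousMap.coe_mk, h]
    simp

namespace WeierstrassThreefold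

/-- The map to the projective line with given homogeneous coordinates. -/
def toP1 {K : Type} [TopologicalSpace K] (v : C(K, Fin 2 → ℂ)) (hv : ∀ k, v k ≠ 0) : C(K, P1) where
  toFun k := Projectivization.mk ℂ (v k) (hv k)
  continuous_toFun := by
    have h : Continuous (Projectivization.mk' ℂ (V := Fin 2 → ℂ)) := continuous_coinduced_rng
    exact h.comp (v.continuous.subtype_mk hv)

theorem hemisphere_toP1_face (i : Fin 3) :
    (toP1 hemisphere₁ hemisphere₁_ne_zero).comp (simplexFace i) =
      (toP1 hemisphere₂ hemisphere₂_ne_zero).comp (simplexFace i) := by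
  ext1 x
  refine (Projectivization.mk_eq_mk_iff' ℂ _ _ _ _).2 ⟨_, (hemisphere_face i x).symm⟩

/-- The class of the projective line, glued from two singular simplices. -/
def sphereClass : H2 P1 := simplexPairClass _ _ hemisphere_toP1_face

/-- The pairing of the first Chern class of a line bundle `L` with `g_*[ℙ¹]`, when the fibres of
`g^* L` are spanned by a vector that depends on the coordinates homogeneously. -/
theorem chernCocycle_push_sphereClass {T E : Type} [TopologicalSpace T] [NormedAddCommGroup E]
    [InnerProductSpace ℂ E] (L : LineField T E) (hL : ∀ x, ∃ v, v ≠ 0 ∧ L.P x v = v)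
    (g : C(P1, T)) (w : (Fin 2 → ℂ) → E) (hw : Continuous w) (D : ℤ)
    (hwL : ∀ t (ht : t ≠ 0), w t ≠ 0 ∧ L.P (g (Projectivization.mk ℂ t ht)) (w t) = w t)
    (hD : ∀ (c : ℂ) t, c ≠ 0 → t ≠ 0 → w (c • t) = c ^ D • w t) :
    cocycleHom (L.chernCocycle hL) (L.chernCocycle_cocycle hL) (H2.push g sphereClass) =
      D * (2 * Real.pi * Complex.I) := by
  rw [sphereClass, cocycleHom_push_simplexPairClass]
  rw [L.chernCocycle_sub_eq hL (v₁ := (⟨w, hw⟩ : C(_, _)).comp hemisphere₁)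
    -- Homogeneity of degree $D$ raises the clutching function to the power $D$, so its logarithm is
    -- multiplied by $D$.
    (v₂ := (⟨w, hw⟩ : C(_, _)).comp hemisphere₂) (l := fun i => (D : ℂ) • triangleLog i)]
  · rw [← sum_triangleLog, Finset.mul_sum]
    refine Finset.sum_congr rfl fun i _ => ?_
    simp only [ContinuousMap.smul_apply, smul_eq_mul]
    ring
  · intro i
    rw [ContinuousMap.comp_assoc, ContinuousMap.comp_assoc, hemisphere_toP1_face]
  · exact fun k => hwL _ (hemisphere₁_ne_zero k)
  · exact fun k => hwL _ (hemisphere₂_ne_zero k)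
  · intro i k
    change w _ = _ • w _
    rw [hemisphere_face, hD _ _ (Complex.exp_ne_zero _) (hemisphere₂_ne_zero _),
      ContinuousMap.smul_apply, smul_eq_mul, Complex.exp_int_mul]

end WeierstrassThreefold

/-! ### The line bundle on the threefold and its degree on curves -/

section LineProj

variable {E : Type*} [NormedAddCommGroup E] [InnerProductSpace ℂ E]

/-- The orthogonal projection onto the line spanned by `w`. -/
def lineProj (w : E) : E →L[ℂ] E := (inner ℂ w w)⁻¹ • InnerProductSpace.rankOne ℂ w w

theorem lineProj_apply (w v : E) : lineProj w v = ((inner ℂ w w)⁻¹ * inner ℂ w v) • w := by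
  simp [lineProj, smul_smul]

theorem lineProj_smul {c : ℂ} (hc : c ≠ 0) (w : E) : lineProj (c • w) = lineProj w := by
  ext v
  by_cases hw : w = 0
  · simp [hw]
  have h1 : inner ℂ w w ≠ 0 := inner_self_ne_zero.2 hw
  have h2 : starRingEnd ℂ c ≠ 0 := by simpa using hc
  simp only [lineProj_apply, inner_smul_left, inner_smul_right, smul_smul]
  congr 1
  field_simp

theorem lineProj_self (w : E) : lineProj w w = w := by
  by_cases hw : w = 0
  · simp [hw]
  rw [lineProj_apply, inv_mul_cancel₀ (inner_self_ne_zero.2 hw), one_smul]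

end LineProj

theorem MvPolynomial.IsHomogeneous.eval_smul {σ R : Type*} [CommSemiring R]
    {P : MvPolynomial σ R} {k : ℕ} (hP : P.IsHomogeneous k) (c : R) (t : σ → R) :
    eval (c • t) P = c ^ k * eval t P := by
  simp only [eval_eq, Finset.mul_sum]
  refine Finset.sum_congr rfl fun m hm => ?_
  rw [hP.degree_eq_sum_deg_support hm]
  simp only [Pi.smul_apply, smul_eq_mul, mul_pow, Finset.prod_mul_distrib,
    Finset.prod_pow_eq_pow_sum]
  ring

namespace WeierstrassThreefold

/-- Sections without common zeros of the line bundle `𝒪(1) ⊗ π^* 𝒪(9)`. -/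
def bundleSections (v : (Fin 3 → ℂ) × (Fin 3 → ℂ)) : EuclideanSpace ℂ (Fin 7) :=
  -- The exponents $3=9-6$ and $9=9-0$ give every entry the weight $c^9m$ of $y$.
  WithLp.toLp 2 ![v.2 1, v.2 0 * v.1 0 ^ 3, v.2 0 * v.1 1 ^ 3, v.2 0 * v.1 2 ^ 3,
    v.2 2 * v.1 0 ^ 9, v.2 2 * v.1 1 ^ 9, v.2 2 * v.1 2 ^ 9]

theorem continuous_bundleSections : Continuous bundleSections := by
  refine (PiLp.continuous_toLp 2 _).comp (continuous_pi fun j => ?_)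
  fin_cases j <;> simp <;> fun_prop

theorem bundleSections_ne_zero {v : (Fin 3 → ℂ) × (Fin 3 → ℂ)} (h1 : v.1 ≠ 0) (h2 : v.2 ≠ 0) :
    bundleSections v ≠ 0 := by
  intro h
  have h' : ∀ j, bundleSections v j = 0 := fun j => by rw [h]; rfl
  have e0 : v.2 1 = 0 := h' 0
  have e1 : v.2 0 * v.1 0 ^ 3 = 0 := h' 1
  have e2 : v.2 0 * v.1 1 ^ 3 = 0 := h' 2
  have e3 : v.2 0 * v.1 2 ^ 3 = 0 := h' 3
  have e4 : v.2 2 * v.1 0 ^ 9 = 0 := h' 4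
  have e5 : v.2 2 * v.1 1 ^ 9 = 0 := h' 5
  have e6 : v.2 2 * v.1 2 ^ 9 = 0 := h' 6
  obtain ⟨j, hj⟩ := Function.ne_iff.1 h1
  refine h2 (funext fun i => ?_)
  fin_cases j <;> fin_cases i <;> simp_all

/-- This serves twice: for invariance under $\mathbb C^\times\times\mathbb C^\times$ and for
homogeneity along a curve. -/
theorem bundleSections_smul (l : ℂ) (s s' w w' : Fin 3 → ℂ) (h1 : w' 1 = l * w 1)
    (h0 : ∀ j, w' 0 * s' j ^ 3 = l * (w 0 * s j ^ 3))
    (h2 : ∀ j, w' 2 * s' j ^ 9 = l * (w 2 * s j ^ 9)) :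
    bundleSections (s', w') = l • bundleSections (s, w) := by
  ext j
  fin_cases j <;> simp [bundleSections, h0, h1, h2]

variable {a b : MvPolynomial (Fin 3) ℂ}

theorem bundleSections_cone_ne_zero (v : Cone a b) : bundleSections v.1 ≠ 0 :=
  bundleSections_ne_zero v.2.1 v.2.2.1

/-- The line bundle dual to `𝒪(1) ⊗ π^* 𝒪(9)` on the threefold. -/
def threefoldLineField (a b : MvPolynomial (Fin 3) ℂ) :
    LineField (Threefold a b) (EuclideanSpace ℂ (Fin 7)) where
  P :=
    { toFun := Quotient.lift (fun v => lineProj (bundleSections v.1)) (by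
        rintro ⟨⟨s, w⟩, hv⟩ ⟨⟨s', w'⟩, hv'⟩ ⟨c, m, h1, h2⟩
        have hc : (c : ℂ) ^ 9 * m ≠ 0 := mul_ne_zero (pow_ne_zero _ c.ne_zero) m.ne_zero
        dsimp only at h1 h2
        refine (lineProj_smul hc _).symm.trans (congrArg lineProj ?_)
        symm
        refine bundleSections_smul _ _ _ _ _ (by simp [h2]) (fun j => ?_) (fun j => ?_)
        · simp [h1, h2]; ring
        · simp [h1, h2]; ring)
      continuous_toFun := by
        refine Continuous.quotient_lift ?_ _
        have hw : Continuous fun v : Cone a b => bundleSections v.1 :=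
          continuous_bundleSections.comp continuous_subtype_val
        refine Continuous.smul (Continuous.inv₀ (hw.inner (𝕜 := ℂ) hw) fun v => ?_) ?_
        · exact (inner_self_ne_zero (𝕜 := ℂ)).2 (bundleSections_cone_ne_zero v)
        · exact ((ContinuousLinearMap.smulRightL ℂ (EuclideanSpace ℂ (Fin 7))
            (EuclideanSpace ℂ (Fin 7))).continuous.comp
              ((innerSL ℂ).continuous.comp hw)).clm_apply hw }
  idem x v := by
    induction x using Quotient.inductionOn with | h x =>
    change lineProj _ (lineProj _ _) = lineProj _ _
    rw [lineProj_apply _ v, map_smul, lineProj_self]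
  rank_one x v v' hv h h' := by
    induction x using Quotient.inductionOn with | h x =>
    change lineProj _ _ = _ at h h'
    rw [lineProj_apply] at h h'
    rw [← h] at hv
    have hne := left_ne_zero_of_smul hv
    generalize (inner ℂ (bundleSections x.1) (bundleSections x.1))⁻¹ *
      inner ℂ (bundleSections x.1) v = r at h hne
    generalize (inner ℂ (bundleSections x.1) (bundleSections x.1))⁻¹ *
      inner ℂ (bundleSections x.1) v' = r' at h'
    exact ⟨r' / r, by rw [← h, smul_smul, div_mul_cancel₀ _ hne, h']⟩

theorem threefoldLineField_nonzero (x : Threefold a b) :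
    ∃ v, v ≠ 0 ∧ (threefoldLineField a b).P x v = v := by
  induction x using Quotient.inductionOn with | h x =>
  exact ⟨_, bundleSections_cone_ne_zero x, lineProj_self _⟩

/-- The pairing with the first Chern class of the line bundle. -/
def chernHom (a b : MvPolynomial (Fin 3) ℂ) : H2 (Threefold a b) →ₗ[ℤ] ℂ :=
  cocycleHom ((threefoldLineField a b).chernCocycle threefoldLineField_nonzero)
    ((threefoldLineField a b).chernCocycle_cocycle threefoldLineField_nonzero)

theorem IsForm.eval_smul {m : ℤ} {P : MvPolynomial (Fin 2) ℂ} (hP : IsForm m P) {c : ℂ}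
    (t : Fin 2 → ℂ) : eval (c • t) P = c ^ m * eval t P := by
  rcases hP with rfl | ⟨k, rfl, hP⟩
  · simp
  · rw [zpow_natCast]
    exact hP.eval_smul c t

/-- `F` and `G` are homogeneous coordinates of the morphism `u`, with twists `d` and `e`. -/
structure Mor.IsGivenBy (u : Mor a b) (d : ℕ) (e : ℤ) (F G : Fin 3 → MvPolynomial (Fin 2) ℂ) :
    Prop where
  form_F : ∀ j, IsForm d (F j)
  form_G_zero : IsForm (6 * d + e) (G 0)
  form_G_one : IsForm (9 * d + e) (G 1)
  form_G_two : IsForm e (G 2)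
  eq_mk : ∀ (t : Fin 2 → ℂ) (ht : t ≠ 0), ∃ v : Cone a b,
    v.1.1 = (fun j => eval t (F j)) ∧ v.1.2 = (fun j => eval t (G j)) ∧
      u.1 (Projectivization.mk ℂ t ht) = ⟦v⟧

theorem Mor.exists_isGivenBy (u : Mor a b) : ∃ d e F G, u.IsGivenBy d e F G := by
  obtain ⟨d, e, F, G, h1, h2, h3, h4, h5⟩ := u.2
  exact ⟨d, e, F, G, h1, h2, h3, h4, h5⟩

theorem zeroSectionLine_isGivenBy :
    (zeroSectionLine a b).IsGivenBy 1 (-9) ![X 0, X 1, 0] ![0, 1, 0] where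
  form_F j := by
    fin_cases j
    · exact Or.inr ⟨1, rfl, isHomogeneous_X _ _⟩
    · exact Or.inr ⟨1, rfl, isHomogeneous_X _ _⟩
    · exact Or.inl rfl
  form_G_zero := Or.inl rfl
  form_G_one := Or.inr ⟨0, rfl, isHomogeneous_one _ _⟩
  form_G_two := Or.inl rfl
  eq_mk t ht := ⟨zeroSectionCone a b ![t 0, t 1, 0] fun h => ht (by
      funext j
      fin_cases j
      · exact congrFun h 0
      · exact congrFun h 1), by
      funext j; fin_cases j <;> simp [zeroSectionCone], by
      funext j; fin_cases j <;> simp [zeroSectionCone], rfl⟩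

theorem chernHom_push {u : Mor a b} {d : ℕ} {e : ℤ} {F G : Fin 3 → MvPolynomial (Fin 2) ℂ}
    (hu : u.IsGivenBy d e F G) :
    chernHom a b (u.push sphereClass) = (9 * d + e : ℤ) * (2 * Real.pi * Complex.I) := by
  refine chernCocycle_push_sphereClass _ _ _
    (fun t => bundleSections (fun j => eval t (F j), fun j => eval t (G j))) ?_ _ ?_ ?_
  · refine continuous_bundleSections.comp ?_
    exact (continuous_pi fun j => MvPolynomial.continuous_eval (F j)).prodMk
      (continuous_pi fun j => MvPolynomial.continuous_eval (G j))
  · intro t ht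
    obtain ⟨v, h1, h2, h3⟩ := hu.eq_mk t ht
    have h4 : (fun j => eval t (F j), fun j => eval t (G j)) = v.1 := Prod.ext h1.symm h2.symm
    rw [h4]
    refine ⟨bundleSections_cone_ne_zero v, ?_⟩
    change (threefoldLineField a b).P (u.1 _) _ = _
    rw [h3]
    exact lineProj_self _
  · intro c t hc ht
    refine bundleSections_smul _ _ _ _ _ (hu.form_G_one.eval_smul t) (fun j => ?_) (fun j => ?_)
    · rw [hu.form_G_zero.eval_smul t, (hu.form_F j).eval_smul t,
        show (9 * d + e : ℤ) = 6 * d + e + (d + d + d) by ring]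
      simp only [zpow_add₀ hc]
      ring
    · rw [hu.form_G_two.eval_smul t, (hu.form_F j).eval_smul t,
        show (9 * d + e : ℤ) = e + (d * 9 : ℕ) by push_cast; ring]
      simp only [zpow_add₀ hc, zpow_natCast, pow_mul]
      ring

/-- Homologous combinations of morphisms have the same degree. -/
theorem degree_eq_of_push_eq {o : H2 P1} (ho : IsFundamentalClass o) {u φ : Mor a b} {i : ℤ}
    (h : u.push o = lineClass a b o + i • φ.push o) {d d' : ℕ} {e e' : ℤ}
    {F G F' G' : Fin 3 → MvPolynomial (Fin 2) ℂ} (hu : u.IsGivenBy d e F G)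
    (hφ : φ.IsGivenBy d' e' F' G') : 9 * d + e = i * (9 * d' + e') := by
  -- The relation between classes is multiplied by $k$ and then paired, so `sphereClass` need not be
  -- known to generate.
  obtain ⟨k, hk⟩ := ho sphereClass
  have hpush : ∀ v : Mor a b, v.push sphereClass = k • v.push o := fun v => by
    rw [hk]
    exact map_zsmul _ k o
  have h1 := chernHom_push hu
  have h2 := chernHom_push hφ
  have h3 := chernHom_push (zeroSectionLine_isGivenBy (a := a) (b := b))
  rw [hpush] at h1 h2 h3
  have h4 : chernHom a b (k • u.push o) = chernHom a b (k • (zeroSectionLine a b).push o) +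
      i • chernHom a b (k • φ.push o) := by
    simp only [h, lineClass, map_zsmul, map_add, zsmul_eq_mul]
    ring
  rw [h1, h2, h3] at h4
  have h5 : (2 * Real.pi * Complex.I : ℂ) ≠ 0 := Complex.two_pi_I_ne_zero
  have h6 : (((9 * d + e : ℤ) : ℂ) - ((i * (9 * d' + e') : ℤ) : ℂ)) * (2 * Real.pi * Complex.I) =
      0 := by
    rw [sub_mul, h4]
    simp [mul_assoc]
  have h7 := (mul_eq_zero.1 h6).resolve_right h5
  exact_mod_cast sub_eq_zero.1 h7

end WeierstrassThreefold

/-! ### Binary forms and base point free pencils -/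

section BinaryForms

/-- The dehomogenization of a binary form. -/
def dehomogenize : MvPolynomial (Fin 2) ℂ →ₐ[ℂ] Polynomial ℂ := aeval ![Polynomial.X, 1]

theorem eval_dehomogenize (P : MvPolynomial (Fin 2) ℂ) (r : ℂ) :
    (dehomogenize P).eval r = eval ![r, 1] P := by
  have : ((Polynomial.aeval r).comp dehomogenize : MvPolynomial (Fin 2) ℂ →ₐ[ℂ] ℂ) =
      aeval ![r, 1] := by
    ext i
    fin_cases i <;> simp [dehomogenize]
  simpa [Polynomial.aeval_def, aeval_def, eval₂_id] using DFunLike.congr_fun this P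

theorem dehomogenize_eq_sum (P : MvPolynomial (Fin 2) ℂ) :
    dehomogenize P = ∑ m ∈ P.support, Polynomial.C (P.coeff m) * Polynomial.X ^ (m 0) := by
  rw [dehomogenize, aeval_def, eval₂_eq']
  refine Finset.sum_congr rfl fun m _ => ?_
  simp [Fin.prod_univ_two]

theorem MvPolynomial.IsHomogeneous.natDegree_dehomogenize_le {P : MvPolynomial (Fin 2) ℂ} {n : ℕ}
    (hP : P.IsHomogeneous n) : (dehomogenize P).natDegree ≤ n := by
  rw [dehomogenize_eq_sum]
  refine Polynomial.natDegree_sum_le_of_forall_le _ _ fun m hm => ?_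
  refine (Polynomial.natDegree_C_mul_X_pow_le _ _).trans ?_
  rw [hP.degree_eq_sum_deg_support hm]
  have := Finsupp.le_degree 0 m
  simpa [Finsupp.degree_apply] using this

theorem MvPolynomial.IsHomogeneous.coeff_dehomogenize {P : MvPolynomial (Fin 2) ℂ} {n : ℕ}
    (hP : P.IsHomogeneous n) : (dehomogenize P).coeff n = eval ![1, 0] P := by
  rw [dehomogenize_eq_sum, Polynomial.finsetSum_coeff, eval_eq']
  refine Finset.sum_congr rfl fun m hm => ?_
  have h := (hP (mem_support_iff.1 hm))
  have h' : m 0 + m 1 = n := by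
    rw [← h]; simp [Finsupp.weight_apply, Finsupp.sum_fintype]
  by_cases h1 : m 1 = 0
  · have : m 0 = n := by omega
    simp [Polynomial.coeff_X_pow, Fin.prod_univ_two, h1, this]
  · have : n ≠ m 0 := by omega
    simp [Polynomial.coeff_X_pow, Fin.prod_univ_two, h1, this]

theorem vec_one_ne_zero (r : ℂ) : (![r, 1] : Fin 2 → ℂ) ≠ 0 := fun h =>
  one_ne_zero (α := ℂ) (congrFun h 1)

theorem vec_infty_ne_zero : (![1, 0] : Fin 2 → ℂ) ≠ 0 := fun h =>
  one_ne_zero (α := ℂ) (congrFun h 0)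

/-- Nonvanishing at $[1:0]$ makes the dehomogenization have full degree $n$, so for $n>0$ it has a
root. -/
theorem MvPolynomial.IsHomogeneous.eq_zero_of_eval_ne_zero {P : MvPolynomial (Fin 2) ℂ} {n : ℕ}
    (hP : P.IsHomogeneous n) (h : ∀ t, t ≠ 0 → eval t P ≠ 0) : n = 0 := by
  by_contra hn
  have h1 : (dehomogenize P).natDegree = n :=
    Polynomial.natDegree_eq_of_le_of_coeff_ne_zero hP.natDegree_dehomogenize_le
      (hP.coeff_dehomogenize ▸ h _ vec_infty_ne_zero)
  obtain ⟨r, hr⟩ := IsAlgClosed.exists_root (dehomogenize P)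
    (Polynomial.degree_pos_of_ne_zero_of_nonunit (by rintro h0; simp [h0] at h1; omega)
      (fun hu => hn (h1 ▸ Polynomial.natDegree_eq_zero_of_isUnit hu))).ne'
  rw [Polynomial.IsRoot, eval_dehomogenize] at hr
  exact h _ (vec_one_ne_zero r) hr

/-- A general member of a base point free pencil of binary forms of degree `n` has `n` different
zeros outside a given finite set. -/
theorem exists_finset_card_eq_of_pencil {A B : MvPolynomial (Fin 2) ℂ} {n : ℕ}
    (hA : A.IsHomogeneous n) (hB : B.IsHomogeneous n) (hn : n ≠ 0)
    (hAB : ∀ t, t ≠ 0 → eval t A ≠ 0 ∨ eval t B ≠ 0) {S : Set ℂ} (hS : S.Finite) :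
    ∃ (c : ℂ) (R : Finset ℂ), R.card = n ∧
      ∀ r ∈ R, r ∉ S ∧ eval ![r, 1] A = c * eval ![r, 1] B := by
  set p := dehomogenize A with hp
  set q := dehomogenize B with hq
  have hpq : ∀ r, p.eval r ≠ 0 ∨ q.eval r ≠ 0 := fun r => by
    rw [hp, hq, eval_dehomogenize, eval_dehomogenize]
    exact hAB _ (vec_one_ne_zero r)
  have hinf : p.coeff n ≠ 0 ∨ q.coeff n ≠ 0 := by
    rw [hp, hq, hA.coeff_dehomogenize, hB.coeff_dehomogenize]
    exact hAB _ vec_infty_ne_zero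
  have hcop : IsCoprime p q :=
    (Polynomial.isCoprime_iff_aeval_ne_zero_of_isAlgClosed ℂ ℂ p q).2 fun r => by
      simpa [Polynomial.aeval_def] using hpq r
  -- For coprime polynomials a zero Wronskian forces both to be constant, contradicting `hinf` since
  -- $n\ne 0$.
  have hW : Polynomial.wronskian p q ≠ 0 := by
    intro h
    obtain ⟨h1, h2⟩ := hcop.wronskian_eq_zero_iff.1 h
    have h3 := Polynomial.derivative_eq_zero.1 h1
    have h4 := Polynomial.derivative_eq_zero.1 h2
    rcases hinf with h | h
    · exact h (Polynomial.coeff_eq_zero_of_natDegree_lt (by omega))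
    · exact h (Polynomial.coeff_eq_zero_of_natDegree_lt (by omega))
  -- The values of $p/q$ to avoid: at infinity, so that $p-cq$ keeps degree $n$; on $S$; and at
  -- zeros of the Wronskian, where $p-cq$ could have a double root.
  have hfin : (insert (p.coeff n / q.coeff n)
      ((fun r => p.eval r / q.eval r) '' (S ∪ {r | (Polynomial.wronskian p q).IsRoot r}))).Finite :=
    ((hS.union (Polynomial.finite_setOfPred_isRoot hW)).image _).insert _
  obtain ⟨c, hc⟩ := hfin.exists_notMem
  rw [Set.mem_insert_iff, not_or] at hc
  have hroot : ∀ r, (p - Polynomial.C c * q).IsRoot r →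
      r ∉ S ∪ {r | (Polynomial.wronskian p q).IsRoot r} := by
    intro r hr hmem
    have h1 : p.eval r = c * q.eval r := by
      simpa [Polynomial.IsRoot, sub_eq_zero] using hr
    have h2 : q.eval r ≠ 0 := fun h0 => (hpq r).elim (fun h => h (by rw [h1, h0, mul_zero]))
      fun h => h h0
    exact hc.2 ⟨r, hmem, by simp only [h1]; field_simp⟩
  have hdeg : (p - Polynomial.C c * q).natDegree = n := by
    refine Polynomial.natDegree_eq_of_le_of_coeff_ne_zero ?_ ?_
    · refine (Polynomial.natDegree_sub_le _ _).trans (max_le hA.natDegree_dehomogenize_le ?_)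
      exact (Polynomial.natDegree_C_mul_le _ _).trans hB.natDegree_dehomogenize_le
    · rw [Polynomial.coeff_sub, Polynomial.coeff_C_mul, sub_ne_zero]
      intro h
      have h2 : q.coeff n ≠ 0 := fun h0 => hinf.elim (fun h' => h' (by rw [h, h0, mul_zero]))
        fun h' => h' h0
      exact hc.1 (by rw [h]; field_simp)
  have hsep : (p - Polynomial.C c * q).Separable := by
    refine (Polynomial.isCoprime_iff_aeval_ne_zero_of_isAlgClosed ℂ ℂ _ _).2 fun r => ?_
    by_contra! h
    have h1 : (p - Polynomial.C c * q).IsRoot r := by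
      simpa [Polynomial.aeval_def, Polynomial.IsRoot] using h.1
    refine hroot r h1 (Or.inr ?_)
    have h2 : p.derivative.eval r = c * q.derivative.eval r := by
      simpa [Polynomial.aeval_def, sub_eq_zero] using h.2
    have h3 : p.eval r = c * q.eval r := by
      simpa [Polynomial.IsRoot, sub_eq_zero] using h1
    simp only [Set.mem_ofPred_eq, Polynomial.IsRoot, Polynomial.wronskian, Polynomial.eval_sub,
      Polynomial.eval_mul, h2, h3]
    ring
  refine ⟨c, (p - Polynomial.C c * q).roots.toFinset, ?_, fun r hr => ?_⟩
  · rw [Multiset.toFinset_card_of_nodup (Polynomial.nodup_roots hsep), ← hdeg]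
    exact (IsAlgClosed.splits _).natDegree_eq_card_roots.symm
  · have h1 := (Polynomial.mem_roots'.1 (Multiset.mem_toFinset.1 hr)).2
    refine ⟨fun h => hroot r h1 (Or.inl h), ?_⟩
    rw [← eval_dehomogenize, ← eval_dehomogenize]
    simpa [Polynomial.IsRoot, sub_eq_zero] using h1

end BinaryForms

/-! ### Degrees of sections and of fibres -/

namespace WeierstrassThreefold

variable {a b : MvPolynomial (Fin 3) ℂ}

theorem eval_weierstrassForm (s w : Fin 3 → ℂ) :
    eval (Sum.elim s w) (weierstrassForm a b) =
      w 2 * w 1 ^ 2 - (w 0 ^ 3 + eval s a * w 0 * w 2 ^ 2 + eval s b * w 2 ^ 3) := by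
  simp [weierstrassForm, eval_rename]

theorem Cone.weierstrass_eq (v : Cone a b) : v.1.2 2 * v.1.2 1 ^ 2 =
    v.1.2 0 ^ 3 + eval v.1.1 a * v.1.2 0 * v.1.2 2 ^ 2 + eval v.1.1 b * v.1.2 2 ^ 3 := by
  have := v.2.2.2
  rwa [eval_weierstrassForm, sub_eq_zero] at this

theorem Cone.x_eq_zero {v : Cone a b} (h : v.1.2 2 = 0) : v.1.2 0 = 0 := by
  have := v.weierstrass_eq
  rw [h] at this
  simpa using this.symm

theorem Cone.y_ne_zero {v : Cone a b} (h : v.1.2 2 = 0) : v.1.2 1 ≠ 0 := fun h1 =>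
  v.2.2.1 (by funext j; fin_cases j; exacts [Cone.x_eq_zero h, h1, h])

theorem IsForm.eq_zero_of_eval_ne_zero {m : ℤ} {P : MvPolynomial (Fin 2) ℂ} (hP : IsForm m P)
    (h : ∀ t, t ≠ 0 → eval t P ≠ 0) : m = 0 := by
  rcases hP with rfl | ⟨k, rfl, hP⟩
  · exact absurd (map_zero _) (h _ vec_infty_ne_zero)
  · rw [hP.eq_zero_of_eval_ne_zero h, Nat.cast_zero]

theorem IsForm.eval_eq_eval {P : MvPolynomial (Fin 2) ℂ} (hP : IsForm 0 P) (t t' : Fin 2 → ℂ) :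
    eval t P = eval t' P := by
  have h : P.IsHomogeneous 0 := by
    rcases hP with rfl | ⟨k, hk, hP⟩
    · exact isHomogeneous_zero _ _ _
    · rwa [Nat.cast_eq_zero.1 hk] at hP
  have h0 := fun t : Fin 2 → ℂ => h.eval_smul 0 t
  simp only [zero_smul, pow_zero, one_mul] at h0
  rw [← h0 t, ← h0 t']

theorem IsForm.isHomogeneous {k : ℕ} {P : MvPolynomial (Fin 2) ℂ} (hP : IsForm k P) :
    P.IsHomogeneous k := by
  rcases hP with rfl | ⟨k', hk, hP⟩
  · exact isHomogeneous_zero _ _ _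
  · rwa [Nat.cast_injective hk] at hP

namespace Mor.IsGivenBy

variable {u : Mor a b} {d : ℕ} {e : ℤ} {F G : Fin 3 → MvPolynomial (Fin 2) ℂ}

theorem proj_eq (hu : u.IsGivenBy d e F G) {t : Fin 2 → ℂ} (ht : t ≠ 0) :
    ∃ h, proj (u.1 (Projectivization.mk ℂ t ht)) =
      Projectivization.mk ℂ (fun j => eval t (F j)) h := by
  obtain ⟨v, h1, -, h3⟩ := hu.eq_mk t ht
  refine ⟨h1 ▸ v.2.1, ?_⟩
  rw [h3]
  change Projectivization.mk ℂ v.1.1 _ = _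
  congr 1

theorem nonneg_of_G_two_ne_zero (hu : u.IsGivenBy d e F G) (h : G 2 ≠ 0) :
    ∃ k : ℕ, (k : ℤ) = e ∧ (G 2).IsHomogeneous k :=
  hu.form_G_two.resolve_left h

/-- The degree of a section over a line. -/
theorem degree_section (hu : u.IsGivenBy d e F G)
    (hinj : Function.Injective fun q => proj (u.1 q)) : 9 * d + e = 0 ∨ 9 ≤ 9 * d + e := by
  -- If $z$ vanishes identically, the curve lies in the zero section and $y$ has no zeros. Otherwise
  -- $e\ge 0$, and injectivity on the base excludes $d=0$.
  by_cases hG : G 2 = 0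
  · left
    refine hu.form_G_one.eq_zero_of_eval_ne_zero fun t ht => ?_
    obtain ⟨v, -, h2, -⟩ := hu.eq_mk t ht
    have h3 : v.1.2 2 = 0 := by rw [h2]; simp [hG]
    have := Cone.y_ne_zero h3
    rwa [h2] at this
  · right
    obtain ⟨k, rfl, -⟩ := hu.nonneg_of_G_two_ne_zero hG
    have hd : d ≠ 0 := by
      rintro rfl
      obtain ⟨h1, h2⟩ := hu.proj_eq vec_infty_ne_zero
      obtain ⟨h3, h4⟩ := hu.proj_eq (vec_one_ne_zero 0)
      have h5 : Projectivization.mk ℂ _ vec_infty_ne_zero =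
          Projectivization.mk ℂ _ (vec_one_ne_zero 0) := by
        refine hinj (h2.trans (Eq.trans ?_ h4.symm))
        congr 1
        funext j
        exact (hu.form_F j).eval_eq_eval _ _
      obtain ⟨c, hc⟩ := (Projectivization.mk_eq_mk_iff' ℂ _ _ _ _).1 h5
      simpa using congrFun hc 0
    omega

/-- A vertical morphism is constant on the base. -/
theorem d_eq_zero (hu : u.IsGivenBy d e F G) {p : P2} (hp : ∀ q, proj (u.1 q) = p) : d = 0 := by
  obtain ⟨h0, h0'⟩ := hu.proj_eq vec_infty_ne_zero
  obtain ⟨j, hj⟩ := Function.ne_iff.1 h0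
  refine Int.natCast_eq_zero.1 ((hu.form_F j).eq_zero_of_eval_ne_zero fun t ht h => hj ?_)
  obtain ⟨h1, h1'⟩ := hu.proj_eq ht
  rw [hp] at h0' h1'
  obtain ⟨c, hc⟩ := (Projectivization.mk_eq_mk_iff' ℂ _ _ _ _).1 (h0'.symm.trans h1')
  have := congrFun hc j
  simp only [Pi.smul_apply, h, smul_zero] at this
  exact this.symm

theorem eq_of_ratio_eq (hu : u.IsGivenBy 0 e F G) {t t' : Fin 2 → ℂ} (ht : t ≠ 0) (ht' : t' ≠ 0)
    (h2 : eval t (G 2) ≠ 0) (h2' : eval t' (G 2) ≠ 0)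
    (hx : eval t (G 0) / eval t (G 2) = eval t' (G 0) / eval t' (G 2))
    (hy : eval t (G 1) / eval t (G 2) = eval t' (G 1) / eval t' (G 2)) :
    u.1 (Projectivization.mk ℂ t ht) = u.1 (Projectivization.mk ℂ t' ht') := by
  obtain ⟨v, e1, e2, e3⟩ := hu.eq_mk t ht
  obtain ⟨v', e1', e2', e3'⟩ := hu.eq_mk t' ht'
  rw [e3, e3']
  rw [div_eq_div_iff h2 h2'] at hx hy
  refine Quotient.sound ⟨1, Units.mk0 _ (div_ne_zero h2' h2), ?_, ?_⟩
  · rw [e1, e1']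
    funext j
    simpa using (hu.form_F j).eval_eq_eval _ _
  · rw [e2, e2']
    funext j
    fin_cases j
    · simp; field_simp; linear_combination -hx
    · simp; field_simp; linear_combination -hy
    · simp; field_simp

/-- The degree of a morphism onto a fibre that is injective away from finitely many points. -/
theorem degree_fiber (hu : u.IsGivenBy d e F G) {p : P2} (hp : Set.range u.1 = proj ⁻¹' {p})
    (hfin : {q : P1 | ∃ q', q' ≠ q ∧ u.1 q' = u.1 q}.Finite) :
    0 < 9 * d + e ∧ 9 * d + e ≤ 3 := by
  have hproj : ∀ q, proj (u.1 q) = p := fun q => by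
    have : u.1 q ∈ proj ⁻¹' {p} := hp ▸ Set.mem_range_self q
    exact this
  obtain rfl := hu.d_eq_zero hproj
  obtain ⟨v₀, e1, -, e3⟩ := hu.eq_mk _ vec_infty_ne_zero
  set s := v₀.1.1 with hs
  have hF : ∀ t, (fun j => eval t (F j)) = s := fun t => by
    rw [e1]; funext j; exact (hu.form_F j).eval_eq_eval _ _
  have hmem : ∀ v : Cone a b, v.1.1 = s → ∃ t, ∃ ht : t ≠ 0, ∃ l : ℂ, l ≠ 0 ∧
      l * eval t (G 2) = v.1.2 2 := by
    intro v hv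
    have h1 : (⟦v⟧ : Threefold a b) ∈ proj ⁻¹' {p} := by
      rw [Set.mem_preimage, Set.mem_singleton_iff,
        ← hproj (Projectivization.mk ℂ _ vec_infty_ne_zero), e3]
      change Projectivization.mk ℂ v.1.1 _ = Projectivization.mk ℂ v₀.1.1 _
      congr 1
    rw [← hp] at h1
    obtain ⟨q, hq⟩ := h1
    induction q using Projectivization.ind with | h t ht =>
    obtain ⟨w, -, f2, f3⟩ := hu.eq_mk t ht
    rw [f3] at hq
    obtain ⟨c, m, -, hm⟩ := Quotient.exact hq
    refine ⟨t, ht, m, m.ne_zero, ?_⟩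
    rw [hm, f2]
    rfl
  -- The fibre contains the affine point $(0,y)$ with $y^2=b$, where $z\ne0$, and the point of the
  -- zero section, where $z=0$. So the form $z$ is not constant and its degree $k$ is positive.
  obtain ⟨y, hy⟩ := IsAlgClosed.exists_pow_nat_eq (eval s b) (n := 2) (by norm_num)
  obtain ⟨t₁, ht₁, l₁, hl₁, h₁⟩ := hmem ⟨(s, ![0, y, 1]), v₀.2.1,
    fun h => one_ne_zero (α := ℂ) (congrFun h 2), by simp [eval_weierstrassForm, hy]⟩ rfl
  obtain ⟨t₂, ht₂, l₂, hl₂, h₂⟩ := hmem (zeroSectionCone a b s v₀.2.1) rfl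
  have hG₁ : eval t₁ (G 2) ≠ 0 := fun h => by simp [h] at h₁
  have hG₂ : eval t₂ (G 2) = 0 := by simpa [zeroSectionCone, hl₂] using h₂
  obtain ⟨k, rfl, hk⟩ := hu.nonneg_of_G_two_ne_zero fun h => hG₁ (by simp [h])
  have hk0 : k ≠ 0 := by
    rintro rfl
    exact hG₁ ((hu.form_G_two.eval_eq_eval t₁ t₂).trans hG₂)
  have hne : ∀ t, t ≠ 0 → eval t (G 1) ≠ 0 ∨ eval t (G 2) ≠ 0 := by
    intro t ht
    by_contra! h
    obtain ⟨w, -, f2, -⟩ := hu.eq_mk t ht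
    have := Cone.y_ne_zero (v := w) (by rw [f2]; exact h.2)
    rw [f2] at this
    exact this h.1
  have hG1 : (G 1).IsHomogeneous k := IsForm.isHomogeneous (by simpa using hu.form_G_one)
  have hS : {r : ℂ | Projectivization.mk ℂ _ (vec_one_ne_zero r) ∈
      {q : P1 | ∃ q', q' ≠ q ∧ u.1 q' = u.1 q}}.Finite := by
    refine hfin.preimage (f := fun r => Projectivization.mk ℂ _ (vec_one_ne_zero r)) ?_
    intro r _ r' _ h
    obtain ⟨c, hc⟩ := (Projectivization.mk_eq_mk_iff' ℂ _ _ _ _).1 h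
    have h0 := congrFun hc 0
    have h1 : c = 1 := by simpa using congrFun hc 1
    simpa [h1] using h0.symm
  -- A general line $y=cz$ pulls back to $k$ different points at which the map is injective. Their
  -- values of $x/z$ are distinct roots of $x^3+ax+b-c^2$, so $k\le 3$.
  obtain ⟨c, R, hR, hRc⟩ := exists_finset_card_eq_of_pencil hG1 hk hk0 hne hS
  have hz : ∀ r ∈ R, eval ![r, 1] (G 2) ≠ 0 := fun r hr h => by
    have := (hRc r hr).2
    rw [h, mul_zero] at this
    exact (hne _ (vec_one_ne_zero r)).elim (fun h' => h' this) fun h' => h' h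
  let Q : Polynomial ℂ := Cubic.toPoly ⟨1, 0, eval s a, eval s b - c ^ 2⟩
  have hQ : Q.natDegree = 3 := Cubic.natDegree_of_a_ne_zero' one_ne_zero
  have hcard : R.card ≤ Q.roots.toFinset.card := by
    refine Finset.card_le_card_of_injOn
      (fun r => eval ![r, 1] (G 0) / eval ![r, 1] (G 2)) (fun r hr => ?_) fun r hr r' hr' h => ?_
    · have hQ0 : Q ≠ 0 := by rintro h; simp [h] at hQ
      obtain ⟨w, f1, f2, -⟩ := hu.eq_mk _ (vec_one_ne_zero r)
      have f1' : w.1.1 = s := f1.trans (hF _)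
      have f := w.weierstrass_eq
      rw [f1', f2] at f
      simp only [(hRc r hr).2] at f
      have := hz r hr
      refine Multiset.mem_toFinset.2 ((Polynomial.mem_roots hQ0).2 ?_)
      simp only [Polynomial.IsRoot, Q, Cubic.toPoly, Polynomial.eval_add, Polynomial.eval_mul,
        Polynomial.eval_C, Polynomial.eval_pow, Polynomial.eval_X]
      field_simp
      linear_combination -f
    · by_contra hrr
      refine (hRc r hr).1 ⟨Projectivization.mk ℂ _ (vec_one_ne_zero r'), fun h' => hrr ?_, ?_⟩
      · obtain ⟨m, hm⟩ := (Projectivization.mk_eq_mk_iff' ℂ _ _ _ _).1 h'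
        have h0 := congrFun hm 0
        have h1 : m = 1 := by simpa using congrFun hm 1
        simpa [h1] using h0
      · refine hu.eq_of_ratio_eq _ _ (hz r' hr') (hz r hr) h.symm ?_
        rw [(hRc r hr).2, (hRc r' hr').2, mul_div_cancel_right₀ _ (hz r hr),
          mul_div_cancel_right₀ _ (hz r' hr')]
  have h3 : k ≤ 3 := by
    rw [← hR, ← hQ]
    exact hcard.trans ((Multiset.toFinset_card_le _).trans (Polynomial.card_roots' Q))
  omega

end Mor.IsGivenBy

/-- The class of a section over a line is `ℓ + i f` with `i = 0` or `3 ≤ i`. -/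
theorem section_class {o : H2 P1} (ho : IsFundamentalClass o) {f : H2 (Threefold a b)}
    (hf : IsFiberClass o f) {σ : Mor a b} (hσ : IsSectionOverLine σ) {i : ℤ}
    (h : σ.push o = lineClass a b o + i • f) : i = 0 ∨ 3 ≤ i := by
  obtain ⟨φ, p, -, hp, hfin, rfl⟩ := hf
  obtain ⟨d, e, F, G, hu⟩ := σ.exists_isGivenBy
  obtain ⟨d', e', F', G', hu'⟩ := φ.exists_isGivenBy
  have h1 := degree_eq_of_push_eq ho h hu hu'
  obtain ⟨h2, h3⟩ := hu'.degree_fiber hp hfin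
  rcases hu.degree_section hσ.1 with h4 | h4
  · left
    rw [h1] at h4
    exact (mul_eq_zero.1 h4).resolve_right h2.ne'
  · right
    rw [h1] at h4
    by_contra! h5
    -- If $i\le 2$, the product of $i$ with a fibre degree in $(0,3]$ is at most $6<9$.
    nlinarith

theorem W_eq_empty {o : H2 P1} (ho : IsFundamentalClass o) {f : H2 (Threefold a b)}
    (hf : IsFiberClass o f) (n : ℕ) {i : ℕ} (h0 : i ≠ 0) (h3 : i < 3) : W o f n i = ∅ := by
  refine Set.eq_empty_of_forall_notMem fun u hu => ?_
  obtain ⟨-, v, hv, h, -⟩ := hu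
  rw [← natCast_zsmul] at h
  have := section_class ho hf hv h
  omega

end WeierstrassThreefold

end

open WeierstrassThreefold in
theorem mainTheorem8 (a b : MvPolynomial (Fin 3) ℂ) (ha : a.IsHomogeneous 12)
    (hb : b.IsHomogeneous 18) (hX : IsNonsingular a b)
    (o : H2 P1) (ho : IsFundamentalClass o)
    (f : H2 (Threefold a b)) (hf : IsFiberClass o f) :
    (∀ n : ℕ, W o f n 1 = ∅ ∧ W o f n 2 = ∅) ∧
    (∀ σ : Mor a b, IsSectionOverLine σ → ∀ i : ℤ,
      σ.push o = lineClass a b o + i • f → i = 0 ∨ 3 ≤ i) :=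
  ⟨fun n => ⟨W_eq_empty ho hf n one_ne_zero (by norm_num),
    W_eq_empty ho hf n two_ne_zero (by norm_num)⟩, fun _ hσ _ h => section_class ho hf hσ h⟩
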